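/- Let $\mathrm{SU}(2)$ act on $\mathbb{C}^2$ in the standard way and on $\mathbb{CP}^1$, the set of lines $l\subset\mathbb{C}^2$ through the origin, and let $T_{2,1}=\{(l,v)\in\mathbb{CP}^1\times\mathbb{C}^2 : v\in l\}$ be the tautological bundle, with fibre $l$ over $l$. Let $\Gamma(T_{2,1})$ be the space of its $L^2$-sections (for the invariant measure), with the action $(g\cdot s)(l)=g\,s(g^{-1}l)$. For $k\ge 1$ let $\Gamma^{2k}(T_{2,1})\subset\Gamma(T_{2,1})$ be the irreducible $\mathrm{SU}(2)$-summand of dimension $2k$, i.e. the isotypic component of $\Gamma(T_{2,1})$ of type $S^{2k-1}(\mathbb{C}^2)$. Its elements are continuous sections, and so have values at points. Put $$H=\bigoplus_{k=1}^{5}\Gamma^{2k}(T_{2,1}),\qquad \tau:H\to\Gamma^2(T_{2,1})\ \text{the projection onto the summand } k=1,$$ and for $l\in\mathbb{CP}^1$ let $e_l:H\to l$, $e_l(s)=s(l)\in l\subset\mathbb{C}^2$, be the evaluation with values in the fibre. A pair $(X,\lambda)$ consists of a finite set $X\subset\mathbb{CP}^1$ and a linear map $\lambda_x:x\to\Gamma^2(T_{2,1})$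 on the fibre $x$ for each $x\in X$. Put $\Psi_{(X,\lambda)}=\sum_{x\in X}\lambda_x\circ e_x : H\to\Gamma^2(T_{2,1})$. The pair is called a $\tau$-design if $\tau(s)=\sum_{x\in X}\lambda_x(e_x(s))$ for all $s\in H$. For $g\in\mathrm{SU}(2)$ let $g\cdot(X,\lambda)=(gX,g\lambda)$, where $g\lambda$ attaches to the point $gx$ the map $z\mapsto g\cdot\lambda_x(g^{-1}z)$. The sum of two pairs lives on the union of the two point sets, maps attached to a common point being added; scalars multiply the maps. For a finite subgroup $G\subset\mathrm{SU}(2)$ let $G\cdot(X,\lambda)=\sum_{g\in G}(gX,g\lambda)$. Let $\varepsilon$ be a primitive fifth root of unity and let $G_{\mathrm{icosa}}\subset\mathrm{SU}(2)$ be the binary icosahedral group, a finite group generated by $$\begin{pmatrix}\varepsilon^3&0\\0&\varepsilon^2\end{pmatrix},\qquad \frac1{\varepsilon^2-\varepsilon^3}\begin{pmatrix}\varepsilon+\varepsilon^4&1\\1&-\varepsilon-\varepsilon^4\end{pmatrix},\qquad \begin{pmatrix}0&1\\-1&0\end{pmatrix}.$$ **Theorem.** Let $(X,\lambda)$ be a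 pair such that $\Psi_{(X,\lambda)}$, regarded as an operator on $H$ via $\Gamma^2(T_{2,1})\subset H$, has trace $2$. Then $$(Y,\lambda_Y)=\frac{1}{\#G_{\mathrm{icosa}}}\,G_{\mathrm{icosa}}\cdot(X,\lambda)$$ is a $\tau$-design. In other words, $\Psi_{(Y,\lambda_Y)}$ restricts to the identity on $\Gamma^2(T_{2,1})$ and to $0$ on $\Gamma^{2k}(T_{2,1})$ for $k=2,3,4,5$. -/

import Mathlib

open MeasureTheory
open scoped LinearAlgebra.Projectivization

noncomputable section

namespace TautDesign

/-! ### Designs attached to a linear map -/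

/-- A pair `(X, λ)` (vector spaces over `ℂ` are `ℂ`-modules, additive inverses being given by
multiplication with `-1`): a finite set `X` of points of `Ω` and, for every `x ∈ X`, a linear map
`λ_x : V_x → W`.  The family is stored with the convention `λ_x = 0` for `x ∉ X`. -/
@[ext]
structure LocalFamily {Ω : Type*} (V : Ω → Type*) (W : Type*)
    [∀ x, AddCommMonoid (V x)] [∀ x, Module ℂ (V x)] [AddCommMonoid W] [Module ℂ W] where
  X : Finset Ω
  lam : ∀ x, V x →ₗ[ℂ] W
  lam_eq_zero : ∀ x, x ∉ X → lam x = 0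

namespace LocalFamily

variable {Ω : Type*} {V : Ω → Type*} {W 𝓗 : Type*}
  [∀ x, AddCommMonoid (V x)] [∀ x, Module ℂ (V x)] [AddCommMonoid W] [Module ℂ W]
  [AddCommMonoid 𝓗] [Module ℂ 𝓗]

/-- The operator `Ψ_{(X,λ)} = ∑_{x ∈ X} λ_x ∘ e_x`. -/
def toOperator (e : ∀ x, 𝓗 →ₗ[ℂ] V x) (A : LocalFamily V W) : 𝓗 →ₗ[ℂ] W :=
  ∑ x ∈ A.X, A.lam x ∘ₗ e x

/-- `(X, λ)` is a `τ`-design, for a linear map `τ : 𝓗₀ → W` defined on a subspace `𝓗₀ ⊆ 𝓗`. -/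
def IsDesign (𝓗₀ : Submodule ℂ 𝓗) (e : ∀ x, 𝓗 →ₗ[ℂ] V x) (τ : 𝓗₀ →ₗ[ℂ] W)
    (A : LocalFamily V W) : Prop :=
  ∀ s : 𝓗₀, τ s = ∑ x ∈ A.X, (A.lam x ∘ₗ e x) (s : 𝓗)

open Classical in
/-- The sum of two pairs lives on the union of the point sets.  Since the families are extended
by zero, `λ_{X ∪ Y}` is `λ_X` on `X \ Y`, `λ_X + λ_Y` on `X ∩ Y` and `λ_Y` on `Y \ X`. -/
instance : Add (LocalFamily V W) where
  add A B :=
    { X := A.X ∪ B.X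
      lam := fun x => A.lam x + B.lam x
      lam_eq_zero := fun x hx => by
        rw [Finset.mem_union, not_or] at hx
        rw [A.lam_eq_zero x hx.1, B.lam_eq_zero x hx.2, add_zero] }

instance : Zero (LocalFamily V W) where
  zero := { X := ∅, lam := fun _ => 0, lam_eq_zero := fun _ _ => rfl }

open Classical in
theorem add_X (A B : LocalFamily V W) : (A + B).X = A.X ∪ B.X := rfl

theorem add_lam (A B : LocalFamily V W) (x : Ω) : (A + B).lam x = A.lam x + B.lam x := rfl

theorem zero_X : (0 : LocalFamily V W).X = ∅ := rfl

theorem zero_lam (x : Ω) : (0 : LocalFamily V W).lam x = 0 := rfl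

instance : AddCommMonoid (LocalFamily V W) where
  add_assoc A B C := by
    apply LocalFamily.ext
    · simp only [add_X, Finset.union_assoc]
    · funext x; simp only [add_lam, add_assoc]
  zero_add A := by
    apply LocalFamily.ext
    · simp only [add_X, zero_X, Finset.empty_union]
    · funext x; simp only [add_lam, zero_lam, zero_add]
  add_zero A := by
    apply LocalFamily.ext
    · simp only [add_X, zero_X, Finset.union_empty]
    · funext x; simp only [add_lam, zero_lam, add_zero]
  add_comm A B := by
    apply LocalFamily.ext
    · simp only [add_X, Finset.union_comm]
    · funext x; simp only [add_lam, add_comm]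
  nsmul := nsmulRec

/-- The scalar multiple `c (X, λ) = (X, c λ)`. -/
instance : SMul ℂ (LocalFamily V W) where
  smul c A :=
    { X := A.X
      lam := fun x => c • A.lam x
      lam_eq_zero := fun x hx => by rw [A.lam_eq_zero x hx, smul_zero] }

end LocalFamily

/-! ### The group `SU(2)` acting on `ℂ²` and on `ℂP¹` -/

/-- The group `SU(2)`. -/
abbrev SU2 : Type := Matrix.specialUnitaryGroup (Fin 2) ℂ

/-- The Hermitian space `ℂ²`. -/
abbrev C2 : Type := EuclideanSpace ℂ (Fin 2)

/-- The complex projective line: lines through the origin in `ℂ²`. -/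
abbrev CP1 : Type := ℙ ℂ C2

/-- The action of `SU(2)` on `ℂ²` is the standard one, by multiplication of matrix and vector. -/
theorem su2_smul_def (g : SU2) (v : C2) :
    g • v = Matrix.toEuclideanLin (g : Matrix (Fin 2) (Fin 2) ℂ) v := rfl

theorem norm_su2_smul (g : SU2) (v : C2) : ‖g • v‖ = ‖v‖ := by
  have hg : star (g : Matrix (Fin 2) (Fin 2) ℂ) * (g : Matrix (Fin 2) (Fin 2) ℂ) = 1 :=
    Matrix.mem_unitaryGroup_iff'.mp (Matrix.mem_specialUnitaryGroup_iff.mp g.2).1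
  have h : inner ℂ (g • v) (g • v) = inner ℂ v v := by
    rw [su2_smul_def, ← LinearMap.adjoint_inner_right, ← Matrix.toEuclideanLin_conjTranspose_eq_adjoint,
      ← Matrix.star_eq_conjTranspose]
    congr 1
    simp only [Matrix.toLpLin_apply, Matrix.mulVec_mulVec, hg, Matrix.one_mulVec]
  rw [inner_self_eq_norm_sq_to_K, inner_self_eq_norm_sq_to_K] at h
  have h2 : ‖g • v‖ ^ 2 = ‖v‖ ^ 2 := by exact_mod_cast h
  exact (pow_left_inj₀ (norm_nonneg _) (norm_nonneg _) two_ne_zero).mp h2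

/-- The linear isometry of `ℂ²` given by an element of `SU(2)`. -/
def su2Isometry (g : SU2) : C2 ≃ₗᵢ[ℂ] C2 :=
  { DistribMulAction.toLinearEquiv ℂ C2 g with norm_map' := norm_su2_smul g }

/-- The quotient topology of `ℂP¹`. -/
instance : TopologicalSpace CP1 :=
  TopologicalSpace.coinduced (fun v : {v : C2 // v ≠ 0} => Projectivization.mk ℂ v.1 v.2)
    inferInstance

instance : MeasurableSpace CP1 := borel CP1

instance : BorelSpace CP1 := ⟨rfl⟩

theorem continuous_mk :
    Continuous (fun v : {v : C2 // v ≠ 0} => Projectivization.mk ℂ v.1 v.2) :=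
  continuous_coinduced_rng

/-- The action of `g` on nonzero vectors. -/
def su2Nonzero (g : SU2) (v : {v : C2 // v ≠ 0}) : {v : C2 // v ≠ 0} :=
  ⟨g • v.1, (smul_ne_zero_iff_ne g).mpr v.2⟩

theorem continuous_su2Nonzero (g : SU2) : Continuous (su2Nonzero g) :=
  Continuous.subtype_mk ((su2Isometry g).continuous.comp continuous_subtype_val) _

theorem continuous_su2_smul (g : SU2) : Continuous (fun l : CP1 => g • l) := by
  refine continuous_coinduced_dom.mpr ?_
  exact continuous_mk.comp (continuous_su2Nonzero g)

/-- The `SU(2)`-invariant measure on `ℂP¹ = SU(2)/U(1)` (unique up to a positive factor, which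
does not affect the space of `L²`-sections), realized as the image of Lebesgue measure on the
punctured unit ball of `ℂ²`. -/
def invMeasure : Measure CP1 :=
  ((volume.restrict (Metric.ball (0 : C2) 1)).comap
    (Subtype.val : {v : C2 // v ≠ 0} → C2)).map
      (fun v : {v : C2 // v ≠ 0} => Projectivization.mk ℂ v.1 v.2)

theorem measurePreserving_ball (g : SU2) :
    MeasurePreserving (fun v : C2 => g • v) (volume.restrict (Metric.ball (0 : C2) 1))
      (volume.restrict (Metric.ball (0 : C2) 1)) := by
  let f : C2 ≃ₗᵢ[ℝ] C2 :=
    { (DistribMulAction.toLinearEquiv ℂ C2 g).restrictScalars ℝ with norm_map' := norm_su2_smul g }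
  have h : MeasurePreserving f volume volume := f.measurePreserving
  have h2 := h.restrict_preimage (s := Metric.ball (0 : C2) 1) Metric.isOpen_ball.measurableSet
  have h3 : f ⁻¹' Metric.ball (0 : C2) 1 = Metric.ball (0 : C2) 1 := by
    ext v
    simp only [Set.mem_preimage, mem_ball_zero_iff, f.norm_map]
  rw [h3] at h2
  exact h2

theorem measurePreserving_nonzero (g : SU2) :
    MeasurePreserving (su2Nonzero g)
      ((volume.restrict (Metric.ball (0 : C2) 1)).comap (Subtype.val : {v : C2 // v ≠ 0} → C2))
      ((volume.restrict (Metric.ball (0 : C2) 1)).comap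
        (Subtype.val : {v : C2 // v ≠ 0} → C2)) := by
  have hs : MeasurableSet {v : C2 | v ≠ 0} := (measurableSet_singleton (0 : C2)).compl
  have he : MeasurableEmbedding (Subtype.val : {v : C2 // v ≠ 0} → C2) :=
    MeasurableEmbedding.subtype_coe hs
  refine ⟨(continuous_su2Nonzero g).measurable, ?_⟩
  ext A hA
  rw [Measure.map_apply (continuous_su2Nonzero g).measurable hA, he.comap_apply, he.comap_apply,
    ← (measurePreserving_ball g).measure_preimage
      (he.measurableSet_image.mpr hA).nullMeasurableSet]
  congr 1
  ext v
  constructor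
  · rintro ⟨w, hw, rfl⟩
    exact ⟨su2Nonzero g w, hw, rfl⟩
  · rintro ⟨w, hw, hwv⟩
    have hv : v ≠ 0 := by
      rintro rfl
      exact w.2 (hwv.trans (smul_zero g))
    refine ⟨⟨v, hv⟩, ?_, rfl⟩
    have : su2Nonzero g ⟨v, hv⟩ = w := Subtype.ext hwv.symm
    rw [Set.mem_preimage, this]
    exact hw

theorem measurePreserving_su2 (g : SU2) :
    MeasurePreserving (fun l : CP1 => g • l) invMeasure invMeasure := by
  refine ⟨(continuous_su2_smul g).measurable, ?_⟩
  have h1 := continuous_mk.measurable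
  have h2 := (continuous_su2Nonzero g).measurable
  unfold invMeasure
  rw [Measure.map_map (continuous_su2_smul g).measurable h1]
  conv_rhs => rw [← (measurePreserving_nonzero g).map_eq, Measure.map_map h1 h2]
  rfl

/-! ### The tautological bundle and its sections -/

/-- The fibre of the tautological bundle `T = {(l, v) : v ∈ l}` over the line `l` is `l`. -/
abbrev Fiber (l : CP1) : Type := l.submodule

theorem smul_mem_fiber (g : SU2) {l : CP1} {v : C2} (hv : v ∈ l.submodule) :
    g • v ∈ (g • l).submodule := by
  induction l using Projectivization.ind with
  | h w hw =>
    rw [Projectivization.smul_mk, Projectivization.submodule_mk, Submodule.mem_span_singleton]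
    rw [Projectivization.submodule_mk, Submodule.mem_span_singleton] at hv
    obtain ⟨c, rfl⟩ := hv
    exact ⟨c, (smul_comm g c w).symm⟩

/-- The action of `g` on the bundle, as a linear map from the fibre over `l` to the fibre over
`g • l`. -/
def fiberMap (g : SU2) (l : CP1) : Fiber l →ₗ[ℂ] Fiber (g • l) :=
  ((DistribSMul.toLinearMap ℂ C2 g).comp l.submodule.subtype).codRestrict _
    (fun v => smul_mem_fiber g v.2)

theorem smul_inv_mem_fiber (g : SU2) {l : CP1} {v : C2} (hv : v ∈ (g⁻¹ • l).submodule) :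
    g • v ∈ l.submodule := by
  have h := smul_mem_fiber g hv
  rwa [smul_inv_smul] at h

/-- The space of `L²`-sections of the tautological bundle: square-integrable classes of maps
`f : ℂP¹ → ℂ²` with `f l ∈ l` for almost every `l`. -/
def L2Sections : Submodule ℂ (Lp C2 2 invMeasure) where
  carrier := {f | ∀ᵐ l ∂invMeasure, f l ∈ l.submodule}
  zero_mem' := by
    filter_upwards [Lp.coeFn_zero C2 2 invMeasure] with l hl
    rw [hl]; exact Submodule.zero_mem _
  add_mem' := by
    intro f f' hf hf'
    filter_upwards [hf, hf', Lp.coeFn_add f f'] with l h1 h2 h3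
    rw [h3]; exact Submodule.add_mem _ h1 h2
  smul_mem' := by
    intro c f hf
    filter_upwards [hf, Lp.coeFn_smul c f] with l h1 h2
    rw [h2]; exact Submodule.smul_mem _ c h1

/-- The map `f ↦ (l ↦ g • f (g⁻¹ • l))` on `L²(ℂP¹; ℂ²)`. -/
def lpAct (g : SU2) : Lp C2 2 invMeasure →ₗ[ℂ] Lp C2 2 invMeasure :=
  ((su2Isometry g : C2 →L[ℂ] C2).compLpₗ 2 invMeasure).comp
    (Lp.compMeasurePreservingₗ ℂ (fun l : CP1 => g⁻¹ • l) (measurePreserving_su2 g⁻¹))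

theorem coeFn_lpAct (g : SU2) (f : Lp C2 2 invMeasure) :
    lpAct g f =ᵐ[invMeasure] fun l => g • f (g⁻¹ • l) := by
  filter_upwards [(su2Isometry g : C2 →L[ℂ] C2).coeFn_compLp
      (Lp.compMeasurePreserving (fun l : CP1 => g⁻¹ • l) (measurePreserving_su2 g⁻¹) f),
    Lp.coeFn_compMeasurePreserving f (measurePreserving_su2 g⁻¹)] with l h1 h2
  refine Eq.trans h1 ?_
  rw [h2]
  rfl

/-- The representation of `SU(2)` on `L²`-sections, `(g • f)(l) = g (f (g⁻¹ l))`. -/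
def l2Rep : Representation ℂ SU2 L2Sections where
  toFun g := (lpAct g).restrict (p := L2Sections) (q := L2Sections) (by
    intro f hf
    filter_upwards [coeFn_lpAct g f, (measurePreserving_su2 g⁻¹).quasiMeasurePreserving.ae hf]
      with l h1 h2
    rw [h1]
    exact smul_inv_mem_fiber g h2)
  map_one' := by
    refine LinearMap.ext fun f => Subtype.ext (Lp.ext ?_)
    filter_upwards [coeFn_lpAct 1 (f : Lp C2 2 invMeasure)] with l h1
    refine h1.trans ?_
    simp
  map_mul' g h := by
    refine LinearMap.ext fun f => Subtype.ext (Lp.ext ?_)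
    filter_upwards [coeFn_lpAct (g * h) (f : Lp C2 2 invMeasure),
      coeFn_lpAct g (lpAct h (f : Lp C2 2 invMeasure)),
      (measurePreserving_su2 g⁻¹).quasiMeasurePreserving.ae
        (coeFn_lpAct h (f : Lp C2 2 invMeasure))] with l h1 h2 h3
    refine h1.trans (Eq.trans ?_ h2.symm)
    rw [h3, mul_smul, mul_inv_rev, mul_smul]

/-- The space of continuous sections of the tautological bundle: continuous maps
`s : ℂP¹ → ℂ²` with `s l ∈ l` for all `l`. -/
def ContSections : Submodule ℂ (CP1 → C2) where
  carrier := {s | Continuous s ∧ ∀ l, s l ∈ l.submodule}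
  zero_mem' := ⟨continuous_const, fun _ => Submodule.zero_mem _⟩
  add_mem' := fun h1 h2 => ⟨h1.1.add h2.1, fun l => Submodule.add_mem _ (h1.2 l) (h2.2 l)⟩
  smul_mem' := fun c _ h => ⟨h.1.const_smul c, fun l => Submodule.smul_mem _ c (h.2 l)⟩

/-- The representation of `SU(2)` on continuous sections, `(g • s)(l) = g (s (g⁻¹ l))`. -/
def contRep : Representation ℂ SU2 ContSections where
  toFun g :=
    { toFun := fun s => ⟨fun l => g • (s : CP1 → C2) (g⁻¹ • l),
        (su2Isometry g).continuous.comp (s.2.1.comp (continuous_su2_smul g⁻¹)),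
        fun l => smul_inv_mem_fiber g (s.2.2 (g⁻¹ • l))⟩
      map_add' := fun s t => Subtype.ext (funext fun l => smul_add g _ _)
      map_smul' := fun c s => Subtype.ext (funext fun l => smul_comm g c _) }
  map_one' := by
    refine LinearMap.ext fun s => Subtype.ext (funext fun l => ?_)
    change (1 : SU2) • (s : CP1 → C2) ((1 : SU2)⁻¹ • l) = (s : CP1 → C2) l
    rw [inv_one, one_smul, one_smul]
  map_mul' g h := by
    refine LinearMap.ext fun s => Subtype.ext (funext fun l => ?_)
    change (g * h) • (s : CP1 → C2) ((g * h)⁻¹ • l)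
      = g • h • (s : CP1 → C2) (h⁻¹ • g⁻¹ • l)
    rw [mul_smul, mul_inv_rev, mul_smul]

theorem contRep_apply (g : SU2) (s : ContSections) (l : CP1) :
    (contRep g s : CP1 → C2) l = g • (s : CP1 → C2) (g⁻¹ • l) := rfl

/-! ### The irreducible summands -/

/-- Substitution `x_j ↦ ∑_i g_{ij} x_i` on `ℂ[x₀, x₁]`.  With `x_j` standing for the `j`-th basis
vector of `ℂ²` this is the action of `g` on the symmetric algebra of `ℂ²`. -/
def polyAct (g : SU2) : MvPolynomial (Fin 2) ℂ →ₐ[ℂ] MvPolynomial (Fin 2) ℂ :=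
  MvPolynomial.aeval fun j =>
    ∑ i, MvPolynomial.C ((g : Matrix (Fin 2) (Fin 2) ℂ) i j) * MvPolynomial.X i

theorem polyAct_X (g : SU2) (j : Fin 2) :
    polyAct g (MvPolynomial.X j) =
      ∑ i, MvPolynomial.C ((g : Matrix (Fin 2) (Fin 2) ℂ) i j) * MvPolynomial.X i :=
  MvPolynomial.aeval_X _ _

/-- The symmetric power `Sⁿ(ℂ²)`, as the space of homogeneous polynomials of degree `n`. -/
abbrev SymPow (n : ℕ) : Submodule ℂ (MvPolynomial (Fin 2) ℂ) :=
  MvPolynomial.homogeneousSubmodule (Fin 2) ℂ n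

theorem polyAct_mem (n : ℕ) (g : SU2) (p : MvPolynomial (Fin 2) ℂ) (hp : p ∈ SymPow n) :
    polyAct g p ∈ SymPow n := by
  rw [MvPolynomial.mem_homogeneousSubmodule] at hp ⊢
  have h := hp.aeval (fun j => ∑ i,
    MvPolynomial.C ((g : Matrix (Fin 2) (Fin 2) ℂ) i j) * MvPolynomial.X i) (n := 1)
    (fun j => MvPolynomial.IsHomogeneous.sum _ _ _ fun i _ =>
      MvPolynomial.isHomogeneous_C_mul_X _ _)
  rwa [one_mul] at h

/-- The representation of `SU(2)` on `Sⁿ(ℂ²)`. -/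
def symRep (n : ℕ) : Representation ℂ SU2 (SymPow n) where
  toFun g := (polyAct g).toLinearMap.restrict (p := SymPow n) (q := SymPow n) (polyAct_mem n g)
  map_one' := by
    have h : polyAct 1 = AlgHom.id ℂ _ := by
      refine MvPolynomial.algHom_ext fun j => ?_
      rw [polyAct_X]
      fin_cases j <;> simp
    refine LinearMap.ext fun p => Subtype.ext ?_
    exact DFunLike.congr_fun h (p : MvPolynomial (Fin 2) ℂ)
  map_mul' g h := by
    have h : polyAct (g * h) = (polyAct g).comp (polyAct h) := by
      refine MvPolynomial.algHom_ext fun j => ?_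
      rw [AlgHom.comp_apply, polyAct_X, polyAct_X, map_sum]
      simp only [map_mul, polyAct_X, MvPolynomial.algHom_C, MvPolynomial.algebraMap_eq,
        Submonoid.coe_mul, Matrix.mul_apply, Fin.sum_univ_two, map_add]
      ring
    refine LinearMap.ext fun p => Subtype.ext ?_
    exact DFunLike.congr_fun h (p : MvPolynomial (Fin 2) ℂ)

/-- The sum of all subrepresentations of the space of `L²`-sections that are images of
`Sⁿ(ℂ²)`, that is, its isotypic component of type `Sⁿ(ℂ²)`. -/
def l2Isotypic (n : ℕ) : Submodule ℂ L2Sections :=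
  ⨆ φ : (symRep n).IntertwiningMap l2Rep, LinearMap.range φ.toLinearMap

theorem l2Rep_mem_l2Isotypic (n : ℕ) (g : SU2) {f : L2Sections} (hf : f ∈ l2Isotypic n) :
    l2Rep g f ∈ l2Isotypic n := by
  have h : l2Isotypic n ≤ (l2Isotypic n).comap (l2Rep g) := by
    refine iSup_le fun φ => ?_
    rintro _ ⟨p, rfl⟩
    rw [Submodule.mem_comap]
    refine Submodule.mem_iSup_of_mem φ ⟨symRep n g p, ?_⟩
    exact DFunLike.congr_fun (φ.isIntertwining' g) p
  exact h hf

/-- The irreducible summand `Γ^{2k}` (`k ≥ 1`) of dimension `2k`: the component of type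
`S^{2k-1}(ℂ²)` of the space of `L²`-sections.  Its elements are classes of continuous sections;
each class is represented here by its continuous representative, so that sections in `Γ^{2k}` can
be evaluated at points. -/
def Gam (k : ℕ) : Submodule ℂ ContSections where
  carrier := {s | ∃ f ∈ l2Isotypic (2 * k - 1),
    ((f : Lp C2 2 invMeasure) : CP1 → C2) =ᵐ[invMeasure] (s : CP1 → C2)}
  zero_mem' := ⟨0, Submodule.zero_mem _, Lp.coeFn_zero C2 2 invMeasure⟩
  add_mem' := by
    rintro s t ⟨f, hf, hfs⟩ ⟨f', hf', hft⟩
    refine ⟨f + f', Submodule.add_mem _ hf hf', ?_⟩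
    exact (Lp.coeFn_add (f : Lp C2 2 invMeasure) (f' : Lp C2 2 invMeasure)).trans (hfs.add hft)
  smul_mem' := by
    rintro c s ⟨f, hf, hfs⟩
    refine ⟨c • f, Submodule.smul_mem _ c hf, ?_⟩
    exact (Lp.coeFn_smul c (f : Lp C2 2 invMeasure)).trans (hfs.const_smul c)

theorem contRep_mem_Gam (k : ℕ) (g : SU2) {s : ContSections} (hs : s ∈ Gam k) :
    contRep g s ∈ Gam k := by
  obtain ⟨f, hf, hfs⟩ := hs
  refine ⟨l2Rep g f, l2Rep_mem_l2Isotypic _ g hf, ?_⟩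
  filter_upwards [coeFn_lpAct g (f : Lp C2 2 invMeasure),
    (measurePreserving_su2 g⁻¹).quasiMeasurePreserving.ae hfs] with l h1 h2
  refine Eq.trans h1 ?_
  rw [h2, contRep_apply]

/-- The action of `g` on `Γ^{2k}`. -/
def gamAct (k : ℕ) (g : SU2) : Gam k →ₗ[ℂ] Gam k :=
  (contRep g).restrict (p := Gam k) (q := Gam k) fun _ hs => contRep_mem_Gam k g hs

/-- The space `H = ⨁_{k=1}^{5} Γ^{2k}`; the index `j` runs through `0, …, 4` and `k = j + 1`. -/
abbrev H : Type := DirectSum (Fin 5) fun j => Gam (j.val + 1)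

/-- The inclusion of the summand `Γ²` into `H`. -/
def inclTwo : Gam 1 →ₗ[ℂ] H :=
  DirectSum.lof ℂ (Fin 5) (fun j => Gam (j.val + 1)) 0

/-- The projection `τ : H → Γ²`. -/
def tau : H →ₗ[ℂ] Gam 1 :=
  DirectSum.component ℂ (Fin 5) (fun j => Gam (j.val + 1)) 0

/-- Evaluation of continuous sections at `l`, with values in the fibre over `l`. -/
def evalSection (l : CP1) : ContSections →ₗ[ℂ] Fiber l where
  toFun s := ⟨(s : CP1 → C2) l, s.2.2 l⟩
  map_add' _ _ := rfl
  map_smul' _ _ := rfl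

/-- The evaluation `e_l : H → T_l`. -/
def evalH (l : CP1) : H →ₗ[ℂ] Fiber l :=
  DirectSum.toModule ℂ (Fin 5) (Fiber l) fun j => evalSection l ∘ₗ (Gam (j.val + 1)).subtype

/-- The operator `Ψ_{(X,λ)} : H → Γ²`. -/
def Psi (A : LocalFamily Fiber (Gam 1)) : H →ₗ[ℂ] Gam 1 :=
  A.toOperator evalH

/-! ### Orbit sums and the binary icosahedral group -/

open Classical in
/-- The translate `(gX, gλ)`: the map attached to `y = g x` is
`z ↦ g (λ_x (g⁻¹ z))`, where `x = g⁻¹ y`. -/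
def translate (g : SU2) (A : LocalFamily Fiber (Gam 1)) : LocalFamily Fiber (Gam 1) where
  X := A.X.image fun x => g • x
  lam y := gamAct 1 g ∘ₗ A.lam (g⁻¹ • y) ∘ₗ fiberMap g⁻¹ y
  lam_eq_zero y hy := by
    have h : g⁻¹ • y ∉ A.X := fun h =>
      hy (Finset.mem_image.mpr ⟨g⁻¹ • y, h, smul_inv_smul g y⟩)
    rw [A.lam_eq_zero _ h, LinearMap.zero_comp, LinearMap.comp_zero]

/-- The orbit sum `G · (X, λ) = ∑_{g ∈ G} (gX, gλ)` for a finite subgroup `G` of `SU(2)`. -/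
def orbitSum (G : Subgroup SU2) (A : LocalFamily Fiber (Gam 1)) : LocalFamily Fiber (Gam 1) :=
  ∑ᶠ g : G, translate (g : SU2) A

/-- The matrix `diag(ε³, ε²)`. -/
def matS (ε : ℂ) : Matrix (Fin 2) (Fin 2) ℂ := !![ε ^ 3, 0; 0, ε ^ 2]

/-- The matrix `(ε² - ε³)⁻¹ (ε + ε⁴, 1; 1, -ε - ε⁴)`. -/
def matT (ε : ℂ) : Matrix (Fin 2) (Fin 2) ℂ :=
  (1 / (ε ^ 2 - ε ^ 3)) • !![ε + ε ^ 4, 1; 1, -ε - ε ^ 4]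

/-- The matrix `(0, 1; -1, 0)`. -/
def matU : Matrix (Fin 2) (Fin 2) ℂ := !![0, 1; -1, 0]


theorem conj_root {ε : ℂ} (hε : IsPrimitiveRoot ε 5) : (starRingEnd ℂ) ε = ε ^ 4 := by
  have h1 : ‖ε‖ = 1 := hε.norm'_eq_one (by norm_num)
  have h2 : ε * (starRingEnd ℂ) ε = 1 := by
    rw [Complex.mul_conj, Complex.normSq_eq_norm_sq, h1]; norm_num
  have h5 : ε ^ 5 = 1 := hε.pow_eq_one
  calc (starRingEnd ℂ) ε = ε ^ 5 * (starRingEnd ℂ) ε := by rw [h5, one_mul]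
    _ = ε ^ 4 * (ε * (starRingEnd ℂ) ε) := by ring
    _ = ε ^ 4 := by rw [h2, mul_one]

theorem root_sum {ε : ℂ} (hε : IsPrimitiveRoot ε 5) :
    1 + ε + ε ^ 2 + ε ^ 3 + ε ^ 4 = 0 := by
  have h := hε.geom_sum_eq_zero (by norm_num)
  simpa [Finset.sum_range_succ] using h

theorem root_diff_ne_zero {ε : ℂ} (hε : IsPrimitiveRoot ε 5) : ε ^ 2 - ε ^ 3 ≠ 0 := by
  have h0 : ε ≠ 0 := hε.ne_zero (by norm_num)
  have h1 : ε ≠ 1 := hε.ne_one (by norm_num)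
  have h : ε ^ 2 - ε ^ 3 = ε ^ 2 * (1 - ε) := by ring
  rw [h]
  exact mul_ne_zero (pow_ne_zero 2 h0) (sub_ne_zero.mpr h1.symm)

theorem matS_mem {ε : ℂ} (hε : IsPrimitiveRoot ε 5) :
    matS ε ∈ Matrix.specialUnitaryGroup (Fin 2) ℂ := by
  have h5 : ε ^ 5 = 1 := hε.pow_eq_one
  have hc := conj_root hε
  rw [Matrix.mem_specialUnitaryGroup_iff, Matrix.mem_unitaryGroup_iff]
  constructor
  · ext i j
    fin_cases i <;> fin_cases j <;>
      simp [matS, Matrix.mul_apply, Fin.sum_univ_two, Matrix.star_apply, hc]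
    · linear_combination (ε ^ 10 + ε ^ 5 + 1) * h5
    · linear_combination (ε ^ 5 + 1) * h5
  · simp [matS, Matrix.det_fin_two]
    linear_combination h5

theorem matT_mem {ε : ℂ} (hε : IsPrimitiveRoot ε 5) :
    matT ε ∈ Matrix.specialUnitaryGroup (Fin 2) ℂ := by
  have h5 : ε ^ 5 = 1 := hε.pow_eq_one
  have hc := conj_root hε
  have hs := root_sum hε
  have hd := root_diff_ne_zero hε
  have key : (ε + ε ^ 4) ^ 2 + 1 = -(ε ^ 2 - ε ^ 3) ^ 2 := by
    linear_combination (ε ^ 3 + ε) * h5 + hs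
  have ha : (starRingEnd ℂ) (ε + ε ^ 4) = ε + ε ^ 4 := by
    rw [map_add, map_pow, hc]
    linear_combination (ε ^ 11 + ε ^ 6 + ε) * h5
  have hcd : (starRingEnd ℂ) (ε ^ 2 - ε ^ 3) = -(ε ^ 2 - ε ^ 3) := by
    rw [map_sub, map_pow, map_pow, hc]
    linear_combination (ε ^ 3 - ε ^ 7 - ε ^ 2) * h5
  have hT : matT ε = (1 / (ε ^ 2 - ε ^ 3)) • !![ε + ε ^ 4, 1; 1, -(ε + ε ^ 4)] := by
    rw [matT, neg_add']
  rw [hT]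
  generalize ε + ε ^ 4 = a at key ha
  generalize ε ^ 2 - ε ^ 3 = d at key hcd hd
  rw [Matrix.mem_specialUnitaryGroup_iff, Matrix.mem_unitaryGroup_iff]
  constructor
  · ext i j
    fin_cases i <;> fin_cases j <;>
      simp [Matrix.mul_apply, Fin.sum_univ_two, Matrix.star_apply, ha, hcd] <;> field_simp <;>
      first | ring1 | linear_combination -key
  · simp [Matrix.det_fin_two]
    field_simp
    linear_combination -key

theorem matU_mem : matU ∈ Matrix.specialUnitaryGroup (Fin 2) ℂ := by
  rw [Matrix.mem_specialUnitaryGroup_iff, Matrix.mem_unitaryGroup_iff]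
  constructor
  · ext i j
    fin_cases i <;> fin_cases j <;>
      simp [matU, Matrix.mul_apply, Fin.sum_univ_two, Matrix.star_apply]
  · simp [matU, Matrix.det_fin_two]

/-- The binary icosahedral group: the subgroup of `SU(2)` generated by the matrices `S`, `T`, `U`,
for a primitive fifth root of unity `ε`. -/
def icosa (ε : ℂ) (hε : IsPrimitiveRoot ε 5) : Subgroup SU2 :=
  Subgroup.closure {⟨matS ε, matS_mem hε⟩, ⟨matT ε, matT_mem hε⟩, ⟨matU, matU_mem⟩}

end TautDesign

end

/-! The operator of an averaged pair is the average of the operator: `Ψ` is additive in the pair and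
turns translation by `g` into conjugation by `g` (`Psi_translate`, `Psi_average`). Hence the
restriction of `Ψ_Y` to each summand `Γ^{2k}` is a `G`-equivariant map to `Γ²`, and it remains to
know these maps.

For `k = 2, …, 5` they vanish. Conceptually, `Hom_G(S^n, ℂ²)` is the space of `G`-invariants in
`S^{n+1} ⊕ S^{n-1}`, and the lowest positive degree of a binary icosahedral invariant is 12. The
proof replaces this by a computation on monomials with the three generators
(`symPow_equivariant_eq_zero`): `S` leaves few possible coefficients, `U` ties the two coordinates
together, and `T` eliminates the rest. To pass to `Γ^{2k}`, an equivariant map is extended to all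
`L²`-sections by averaging and then composed with each intertwiner from `S^{2k-1}`
(`gam_equivariant_eq_zero`). Neither multiplicity one nor continuity of the whole isotypic component
is needed.

For `k = 1`, sections in `Γ²` are the projections of fixed vectors to the fibres, which embeds `Γ²`
equivariantly in `ℂ²` (`gamVec`). A map commuting with `S` and `U` is then a scalar. Averaging
preserves the trace, which is 2, so the scalar is 1 (`eq_id_of_trace_eq_two`).

Averaging needs `G` finite; this is proved through a finite list of normal forms stable under left
multiplication by the generators (`coe_mem_icosaSet`). -/

open MeasureTheory
open scoped LinearAlgebra.Projectivization

noncomputable section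

namespace TautDesign

/-! ### Averaging linear maps over a finite group -/

section Average

variable {G V V' W : Type*} [Group G] [AddCommGroup V] [Module ℂ V] [AddCommGroup V'] [Module ℂ V']
  [AddCommGroup W] [Module ℂ W]

/-- The average `#G⁻¹ ∑_{g ∈ G} σ(g) ∘ L ∘ ρ(g)⁻¹`. -/
def average [Fintype G] (ρ : Representation ℂ G V) (σ : Representation ℂ G W) (L : V →ₗ[ℂ] W) :
    V →ₗ[ℂ] W :=
  ((1 : ℂ) / (Nat.card G : ℂ)) • ∑ g : G, σ g ∘ₗ L ∘ₗ ρ g⁻¹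

variable [Fintype G] (ρ : Representation ℂ G V) (ρ' : Representation ℂ G V')
  (σ : Representation ℂ G W)

theorem average_apply (L : V →ₗ[ℂ] W) (v : V) :
    average ρ σ L v = ((1 : ℂ) / (Nat.card G : ℂ)) • ∑ g : G, σ g (L (ρ g⁻¹ v)) := by
  simp [average, LinearMap.sum_apply]

theorem average_equivariant (L : V →ₗ[ℂ] W) (h : G) (v : V) :
    average ρ σ L (ρ h v) = σ h (average ρ σ L v) := by
  rw [average_apply, average_apply, map_smul, map_sum]
  congr 1
  -- Substituting `hg` for `g` turns `ρ((hg)⁻¹) ρ(h)` into `ρ(g⁻¹)` and splits off `σ(h)`.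
  rw [← Equiv.sum_comp (Equiv.mulLeft h)]
  refine Finset.sum_congr rfl fun g _ => ?_
  rw [Equiv.coe_mulLeft, map_mul, mul_inv_rev, map_mul, Module.End.mul_apply, Module.End.mul_apply,
    ← Module.End.mul_apply (ρ h⁻¹), ← map_mul, inv_mul_cancel, map_one, Module.End.one_apply]

theorem average_comp (E : V →ₗ[ℂ] V') (hE : ∀ g v, E (ρ g v) = ρ' g (E v)) (L : V' →ₗ[ℂ] W) (v : V) :
    average ρ' σ L (E v) = average ρ σ (L ∘ₗ E) v := by
  simp only [average_apply, LinearMap.comp_apply, hE]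

theorem card_ne_zero : (Nat.card G : ℂ) ≠ 0 := by
  rw [Nat.card_eq_fintype_card]
  exact Nat.cast_ne_zero.mpr Fintype.card_ne_zero

theorem average_eq_self (L : V →ₗ[ℂ] W) (hL : ∀ g v, L (ρ g v) = σ g (L v)) :
    average ρ σ L = L := by
  ext v
  rw [average_apply]
  have h : ∀ g : G, σ g (L (ρ g⁻¹ v)) = L v := fun g => by
    rw [← hL, ← Module.End.mul_apply, ← map_mul, mul_inv_cancel, map_one, Module.End.one_apply]
  simp only [h, Finset.sum_const, Finset.card_univ]
  rw [← Nat.card_eq_fintype_card, ← Nat.cast_smul_eq_nsmul ℂ, smul_smul, one_div_mul_cancel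
    (card_ne_zero), one_smul]

theorem trace_average (L : V →ₗ[ℂ] V) :
    LinearMap.trace ℂ V (average ρ ρ L) = LinearMap.trace ℂ V L := by
  have h : ∀ g : G, LinearMap.trace ℂ V (ρ g ∘ₗ L ∘ₗ ρ g⁻¹) = LinearMap.trace ℂ V L := fun g => by
    have h1 := LinearMap.trace_mul_comm ℂ (ρ g) (L * ρ g⁻¹)
    have h2 : L * ρ g⁻¹ * ρ g = L := by
      rw [mul_assoc, ← map_mul, inv_mul_cancel, map_one, mul_one]
    rw [h2] at h1
    exact h1
  rw [average, map_smul, map_sum]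
  simp only [h, Finset.sum_const, Finset.card_univ]
  rw [← Nat.card_eq_fintype_card, ← Nat.cast_smul_eq_nsmul ℂ, smul_smul, one_div_mul_cancel
    (card_ne_zero), one_smul]

/-- An equivariant map on `V` vanishes if `V` embeds equivariantly into a subspace on which all
equivariant maps vanish. -/
theorem equivariant_eq_zero_of_injective (E : V →ₗ[ℂ] V') (hinj : Function.Injective E)
    (hE : ∀ g v, E (ρ g v) = ρ' g (E v)) (N : Submodule ℂ V') (hEN : ∀ v, E v ∈ N)
    (hN : ∀ L : V' →ₗ[ℂ] W, (∀ g v, L (ρ' g v) = σ g (L v)) → N ≤ LinearMap.ker L)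
    (Q : V →ₗ[ℂ] W) (hQ : ∀ g v, Q (ρ g v) = σ g (Q v)) : Q = 0 := by
  obtain ⟨R, hR⟩ := E.exists_leftInverse_of_injective (LinearMap.ker_eq_bot_of_injective hinj)
  refine LinearMap.ext fun v => ?_
  -- `R` is only linear. Averaging `Q ∘ R` makes it equivariant on `V'`, while its composite with
  -- `E` remains `Q`.
  have h := average_comp ρ ρ' σ E hE (Q ∘ₗ R) v
  rw [LinearMap.comp_assoc, hR, LinearMap.comp_id, average_eq_self ρ σ Q hQ] at h
  rw [← h]
  exact hN _ (average_equivariant ρ' σ _) (hEN v)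

end Average

/-! ### The operator of an averaged pair -/

namespace LocalFamily

variable {Ω : Type*} {V : Ω → Type*} {W 𝓗 : Type*}
  [∀ x, AddCommMonoid (V x)] [∀ x, Module ℂ (V x)] [AddCommMonoid W] [Module ℂ W]
  [AddCommMonoid 𝓗] [Module ℂ 𝓗]

/-- Extension by zero allows two pairs to be summed over one common point set, which gives
additivity. -/
theorem toOperator_eq_sum (e : ∀ x, 𝓗 →ₗ[ℂ] V x) (A : LocalFamily V W) {Z : Finset Ω}
    (hZ : A.X ⊆ Z) : A.toOperator e = ∑ x ∈ Z, A.lam x ∘ₗ e x :=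
  Finset.sum_subset hZ fun x _ hx => by rw [A.lam_eq_zero x hx, LinearMap.zero_comp]

/-- `A ↦ Ψ_A` as an additive map. -/
def toOperatorHom (e : ∀ x, 𝓗 →ₗ[ℂ] V x) : LocalFamily V W →+ (𝓗 →ₗ[ℂ] W) where
  toFun A := A.toOperator e
  map_zero' := Finset.sum_empty
  map_add' A B := by
    classical
    rw [toOperator_eq_sum e A (Finset.subset_union_left (s₂ := B.X)),
      toOperator_eq_sum e B (Finset.subset_union_right (s₁ := A.X)), ← Finset.sum_add_distrib]
    exact Finset.sum_congr rfl fun x _ => LinearMap.add_comp _ _ _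

theorem toOperator_smul (e : ∀ x, 𝓗 →ₗ[ℂ] V x) (c : ℂ) (A : LocalFamily V W) :
    (c • A).toOperator e = c • A.toOperator e := by
  rw [toOperator, toOperator, Finset.smul_sum]
  exact Finset.sum_congr rfl fun x _ => LinearMap.smul_comp _ _ _

end LocalFamily

theorem gamAct_coe (k : ℕ) (g : SU2) (s : Gam k) :
    ((gamAct k g s : Gam k) : ContSections) = contRep g s := rfl

/-- The representation of `SU(2)` on `Γ^{2k}`. -/
def gamRep (k : ℕ) : Representation ℂ SU2 (Gam k) where
  toFun := gamAct k
  map_one' := LinearMap.ext fun s => Subtype.ext (by rw [gamAct_coe, map_one]; rfl)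
  map_mul' g h := LinearMap.ext fun s => Subtype.ext (by rw [gamAct_coe, map_mul]; rfl)

/-- The inclusion of the summand with index `j` into `H`. -/
abbrev incl (j : Fin 5) : Gam (j.val + 1) →ₗ[ℂ] H :=
  DirectSum.lof ℂ (Fin 5) (fun j => Gam (j.val + 1)) j

theorem evalH_incl (l : CP1) (j : Fin 5) (s : Gam (j.val + 1)) :
    evalH l (incl j s) = evalSection l (s : ContSections) := by
  rw [evalH, incl, DirectSum.toModule_lof]
  rfl

theorem fiberMap_evalH (g : SU2) (y : CP1) (j : Fin 5) (s : Gam (j.val + 1)) :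
    fiberMap g⁻¹ y (evalH y (incl j s)) = evalH (g⁻¹ • y) (incl j (gamRep _ g⁻¹ s)) := by
  rw [evalH_incl, evalH_incl]
  refine Subtype.ext ?_
  change g⁻¹ • (s : ContSections).1 y = g⁻¹ • (s : ContSections).1 (g⁻¹⁻¹ • g⁻¹ • y)
  rw [inv_inv, smul_inv_smul]

/-- Substitute `y = gx` in the sum and use that `g⁻¹ s(y)` is the value of `g⁻¹ · s` at `g⁻¹ y`. -/
theorem Psi_translate (g : SU2) (A : LocalFamily Fiber (Gam 1)) (j : Fin 5) (s : Gam (j.val + 1)) :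
    Psi (translate g A) (incl j s) = gamRep 1 g (Psi A (incl j (gamRep _ g⁻¹ s))) := by
  classical
  let f : CP1 → Gam 1 := fun x => A.lam x (evalH x (incl j (gamRep _ g⁻¹ s)))
  have h1 : Psi (translate g A) (incl j s)
      = ∑ y ∈ A.X.image (fun x => g • x), gamRep 1 g (f (g⁻¹ • y)) := by
    rw [Psi, LocalFamily.toOperator, LinearMap.sum_apply]
    refine Finset.sum_congr (by ext; simp [translate]) fun y _ => ?_
    change gamRep 1 g (A.lam (g⁻¹ • y) (fiberMap g⁻¹ y (evalH y (incl j s)))) = _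
    rw [fiberMap_evalH]
  rw [h1, Finset.sum_image fun x _ y _ h => MulAction.injective g h, Psi, LocalFamily.toOperator,
    LinearMap.sum_apply, map_sum]
  refine Finset.sum_congr rfl fun x _ => ?_
  rw [inv_smul_smul]
  rfl

theorem Psi_average (G : Subgroup SU2) [Fintype G] (A : LocalFamily Fiber (Gam 1)) (j : Fin 5) :
    Psi (((1 : ℂ) / (Nat.card G : ℂ)) • orbitSum G A) ∘ₗ incl j =
      average (V := Gam (j.val + 1)) (W := Gam 1) ((gamRep (j.val + 1)).comp G.subtype) ((gamRep 1).comp G.subtype)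
        (Psi A ∘ₗ incl j) := by
  have h : Psi (orbitSum G A) = ∑ g : G, Psi (translate (g : SU2) A) := by
    rw [orbitSum, finsum_eq_sum_of_fintype]
    exact map_sum (LocalFamily.toOperatorHom evalH) _ _
  have h2 : Psi (((1 : ℂ) / (Nat.card G : ℂ)) • orbitSum G A)
      = ((1 : ℂ) / (Nat.card G : ℂ)) • Psi (orbitSum G A) := LocalFamily.toOperator_smul _ _ _
  refine LinearMap.ext fun s => ?_
  rw [average_apply, LinearMap.comp_apply, h2, h, LinearMap.smul_apply, LinearMap.sum_apply]
  congr 1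
  exact Finset.sum_congr rfl fun g _ => Psi_translate (g : SU2) A j s

/-! ### Finiteness of the binary icosahedral group -/

theorem matS_pow (ε : ℂ) (k : ℕ) : matS ε ^ k = !![ε ^ (3 * k), 0; 0, ε ^ (2 * k)] := by
  induction k with
  | zero => simp [Matrix.one_fin_two]
  | succ k ih =>
    rw [pow_succ, ih, matS, Matrix.mul_fin_two]
    congr! 4 <;> ring_nf

theorem matS_pow_five {ε : ℂ} (hε : IsPrimitiveRoot ε 5) : matS ε ^ 5 = 1 := by
  have h5 : ε ^ 5 = 1 := hε.pow_eq_one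
  rw [matS_pow, Matrix.one_fin_two, mul_comm 3 5, mul_comm 2 5, pow_mul, pow_mul, h5, one_pow,
    one_pow]

theorem matU_sq : matU * matU = -1 := by
  simp [matU, Matrix.one_fin_two]

theorem matT_eq (ε : ℂ) : matT ε = (1 / (ε ^ 2 - ε ^ 3)) • !![ε + ε ^ 4, 1; 1, -(ε + ε ^ 4)] := by
  rw [matT, neg_add']

theorem matT_sq {ε : ℂ} (hε : IsPrimitiveRoot ε 5) : matT ε * matT ε = -1 := by
  have h5 : ε ^ 5 = 1 := hε.pow_eq_one
  have hs := root_sum hε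
  rw [matT_eq]
  have hd := mul_one_div_cancel (root_diff_ne_zero hε)
  generalize 1 / (ε ^ 2 - ε ^ 3) = δ at hd ⊢
  ext i j
  fin_cases i <;> fin_cases j <;> simp <;> grind

theorem matU_mul_matT (ε : ℂ) : matU * matT ε = (-1 : ℂ) • (matT ε * matU) := by
  ext i j
  fin_cases i <;> fin_cases j <;> simp [matT_eq, matU] <;> ring

/-- Conjugation by `U` inverts `S`; the exponent `4 * k` stands for `-k` modulo 5 and stays natural.
-/
theorem matU_mul_matS_pow {ε : ℂ} (hε : IsPrimitiveRoot ε 5) (k : ℕ) :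
    matU * matS ε ^ k = matS ε ^ (4 * k) * matU := by
  have h5 : ε ^ 5 = 1 := hε.pow_eq_one
  have h1 : ε ^ (3 * (4 * k)) = ε ^ (2 * k) := by
    rw [show 3 * (4 * k) = 5 * (2 * k) + 2 * k by ring, pow_add, pow_mul, h5, one_pow, one_mul]
  have h2 : ε ^ (2 * (4 * k)) = ε ^ (3 * k) := by
    rw [show 2 * (4 * k) = 5 * k + 3 * k by ring, pow_add, pow_mul, h5, one_pow, one_mul]
  rw [matS_pow, matS_pow, h1, h2]
  simp [matU]

/-- This and the next three relations remove a second `T` from a word. With `δ` for the inverse of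
`ε² - ε³`, they are polynomial identities modulo `ε⁵ = 1`, `1 + ε + ε² + ε³ + ε⁴ = 0` and `(ε² -
ε³)δ = 1`. The middle two express `(S²T)³ = -1` and `(S³T)³ = 1`. -/
theorem matT_mul_matS_mul_matT {ε : ℂ} (hε : IsPrimitiveRoot ε 5) :
    matT ε * matS ε ^ 1 * matT ε = (-1 : ℂ) • (matS ε ^ 1 * matT ε * matS ε ^ 4 * matU) := by
  have h5 : ε ^ 5 = 1 := hε.pow_eq_one
  have hs := root_sum hε
  rw [matS_pow, matS_pow, matT_eq]
  have hd := mul_one_div_cancel (root_diff_ne_zero hε)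
  generalize 1 / (ε ^ 2 - ε ^ 3) = δ at hd ⊢
  ext i j
  fin_cases i <;> fin_cases j <;> simp [matU] <;> grind

theorem matT_mul_matS_sq_mul_matT {ε : ℂ} (hε : IsPrimitiveRoot ε 5) :
    matT ε * matS ε ^ 2 * matT ε = (1 : ℂ) • (matS ε ^ 3 * matT ε * matS ε ^ 3 * 1) := by
  have h5 : ε ^ 5 = 1 := hε.pow_eq_one
  have hs := root_sum hε
  rw [matS_pow, matS_pow, matT_eq]
  have hd := mul_one_div_cancel (root_diff_ne_zero hε)
  generalize 1 / (ε ^ 2 - ε ^ 3) = δ at hd ⊢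
  ext i j
  fin_cases i <;> fin_cases j <;> simp <;> grind

theorem matT_mul_matS_cube_mul_matT {ε : ℂ} (hε : IsPrimitiveRoot ε 5) :
    matT ε * matS ε ^ 3 * matT ε = (-1 : ℂ) • (matS ε ^ 2 * matT ε * matS ε ^ 2 * 1) := by
  have h5 : ε ^ 5 = 1 := hε.pow_eq_one
  have hs := root_sum hε
  rw [matS_pow, matS_pow, matT_eq]
  have hd := mul_one_div_cancel (root_diff_ne_zero hε)
  generalize 1 / (ε ^ 2 - ε ^ 3) = δ at hd ⊢
  ext i j
  fin_cases i <;> fin_cases j <;> simp <;> grind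

theorem matT_mul_matS_pow_four_mul_matT {ε : ℂ} (hε : IsPrimitiveRoot ε 5) :
    matT ε * matS ε ^ 4 * matT ε = (1 : ℂ) • (matS ε ^ 4 * matT ε * matS ε ^ 1 * matU) := by
  have h5 : ε ^ 5 = 1 := hε.pow_eq_one
  have hs := root_sum hε
  rw [matS_pow, matS_pow, matT_eq]
  have hd := mul_one_div_cancel (root_diff_ne_zero hε)
  generalize 1 / (ε ^ 2 - ε ^ 3) = δ at hd ⊢
  ext i j
  fin_cases i <;> fin_cases j <;> simp [matU] <;> grind

/-- The matrices `±Sⁱ`, `±SⁱU`, `±SⁱTSʲ`, `±SⁱTSʲU`. -/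
def icosaSet (ε : ℂ) : Set (Matrix (Fin 2) (Fin 2) ℂ) :=
  {M | ∃ (c : ℂ) (i j : ℕ) (V : Matrix (Fin 2) (Fin 2) ℂ), (c = 1 ∨ c = -1) ∧
    (V = 1 ∨ V = matU) ∧ (M = c • (matS ε ^ i * V) ∨ M = c • (matS ε ^ i * matT ε * matS ε ^ j * V))}

theorem matS_pow_mod {ε : ℂ} (hε : IsPrimitiveRoot ε 5) (i : ℕ) :
    matS ε ^ i = matS ε ^ (i % 5) := pow_eq_pow_mod i (matS_pow_five hε)

theorem icosaSet_finite {ε : ℂ} (hε : IsPrimitiveRoot ε 5) : (icosaSet ε).Finite := by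
  have hc : ({1, -1} : Set ℂ).Finite := Set.toFinite _
  have hV : ({1, matU} : Set (Matrix (Fin 2) (Fin 2) ℂ)).Finite := Set.toFinite _
  have hI : (Set.Iio 5 : Set ℕ).Finite := Set.finite_Iio 5
  have hP := (hc.prod hV).prod (hI.prod hI)
  refine ((hP.image fun x => x.1.1 • (matS ε ^ x.2.1 * x.1.2)).union
    (hP.image fun x => x.1.1 • (matS ε ^ x.2.1 * matT ε * matS ε ^ x.2.2 * x.1.2))).subset ?_
  rintro M ⟨c, i, j, V, hc, hV, hM⟩
  rw [matS_pow_mod hε i, matS_pow_mod hε j] at hM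
  have hmem : ((c, V), (i % 5, j % 5)) ∈ (({1, -1} : Set ℂ) ×ˢ
      ({1, matU} : Set (Matrix (Fin 2) (Fin 2) ℂ))) ×ˢ (Set.Iio 5 ×ˢ Set.Iio 5 : Set (ℕ × ℕ)) :=
    ⟨⟨hc, hV⟩, Nat.mod_lt _ (by norm_num), Nat.mod_lt _ (by norm_num)⟩
  rcases hM with rfl | rfl
  · exact Or.inl ⟨_, hmem, rfl⟩
  · exact Or.inr ⟨_, hmem, rfl⟩

theorem neg_mem_icosaSet {ε : ℂ} {M : Matrix (Fin 2) (Fin 2) ℂ} (hM : M ∈ icosaSet ε) :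
    (-1 : ℂ) • M ∈ icosaSet ε := by
  obtain ⟨c, i, j, V, hc, hV, hM⟩ := hM
  refine ⟨-c, i, j, V, ?_, hV, ?_⟩
  · rcases hc with rfl | rfl <;> simp
  · rcases hM with rfl | rfl
    · exact Or.inl (by rw [smul_smul, neg_one_mul])
    · exact Or.inr (by rw [smul_smul, neg_one_mul])

theorem smul_mem_icosaSet {ε : ℂ} {M : Matrix (Fin 2) (Fin 2) ℂ} (hM : M ∈ icosaSet ε) {c : ℂ}
    (hc : c = 1 ∨ c = -1) : c • M ∈ icosaSet ε := by
  rcases hc with rfl | rfl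
  · rwa [one_smul]
  · exact neg_mem_icosaSet hM

theorem matS_mul_mem_icosaSet {ε : ℂ} {M : Matrix (Fin 2) (Fin 2) ℂ} (hM : M ∈ icosaSet ε) :
    matS ε * M ∈ icosaSet ε := by
  obtain ⟨c, i, j, V, hc, hV, hM⟩ := hM
  refine ⟨c, i + 1, j, V, hc, hV, ?_⟩
  rcases hM with rfl | rfl
  · exact Or.inl (by rw [pow_succ', mul_smul_comm, mul_assoc])
  · exact Or.inr (by rw [pow_succ', mul_smul_comm]; simp only [mul_assoc])

theorem matU_mul_eq {V : Matrix (Fin 2) (Fin 2) ℂ} (hV : V = 1 ∨ V = matU) :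
    ∃ (c : ℂ) (V' : Matrix (Fin 2) (Fin 2) ℂ), (c = 1 ∨ c = -1) ∧ (V' = 1 ∨ V' = matU) ∧
      matU * V = c • V' := by
  rcases hV with rfl | rfl
  · exact ⟨1, matU, by simp, by simp, by simp⟩
  · exact ⟨-1, 1, by simp, by simp, by simp [matU_sq]⟩

theorem matU_mul_mem_icosaSet {ε : ℂ} (hε : IsPrimitiveRoot ε 5) {M : Matrix (Fin 2) (Fin 2) ℂ}
    (hM : M ∈ icosaSet ε) : matU * M ∈ icosaSet ε := by
  obtain ⟨c, i, j, V, hc, hV, hM⟩ := hM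
  obtain ⟨c', V', hc', hV', h⟩ := matU_mul_eq hV
  rcases hM with rfl | rfl
  · have h2 : matU * (c • (matS ε ^ i * V)) = c • c' • (1 : ℂ) • (matS ε ^ (4 * i) * V') := by
      rw [mul_smul_comm, ← mul_assoc, matU_mul_matS_pow hε, mul_assoc, h, mul_smul_comm, one_smul]
    rw [h2]
    exact smul_mem_icosaSet (smul_mem_icosaSet ⟨1, _, 0, V', by simp, hV', Or.inl rfl⟩ hc') hc
  · have h2 : matU * (c • (matS ε ^ i * matT ε * matS ε ^ j * V))
        = c • c' • (-1 : ℂ) • (matS ε ^ (4 * i) * matT ε * matS ε ^ (4 * j) * V') := by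
      calc matU * (c • (matS ε ^ i * matT ε * matS ε ^ j * V))
          = c • ((matU * matS ε ^ i) * matT ε * matS ε ^ j * V) := by
            rw [mul_smul_comm]; simp only [mul_assoc]
        _ = c • (matS ε ^ (4 * i) * (matU * matT ε) * matS ε ^ j * V) := by
            rw [matU_mul_matS_pow hε]; simp only [mul_assoc]
        _ = c • (-1 : ℂ) • (matS ε ^ (4 * i) * matT ε * (matU * matS ε ^ j) * V) := by
            rw [matU_mul_matT]; simp only [mul_assoc, mul_smul_comm, smul_mul_assoc]
        _ = c • (-1 : ℂ) • (matS ε ^ (4 * i) * matT ε * matS ε ^ (4 * j) * (matU * V)) := by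
            rw [matU_mul_matS_pow hε]; simp only [mul_assoc]
        _ = _ := by rw [h, mul_smul_comm, smul_comm (-1 : ℂ) c']
    rw [h2]
    exact smul_mem_icosaSet (smul_mem_icosaSet ⟨-1, _, _, V', by simp, hV', Or.inr rfl⟩ hc') hc

/-- What remains after a `T Sᵏ T` relation: a possible `U` in the middle is moved to the right past
the power of `S`. -/
theorem mul_matS_pow_mem_icosaSet {ε : ℂ} (hε : IsPrimitiveRoot ε 5) (i j k : ℕ)
    {V W : Matrix (Fin 2) (Fin 2) ℂ} (hV : V = 1 ∨ V = matU) (hW : W = 1 ∨ W = matU) :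
    matS ε ^ i * matT ε * matS ε ^ j * W * (matS ε ^ k * V) ∈ icosaSet ε := by
  rcases hW with rfl | rfl
  · refine ⟨1, i, j + k, V, by simp, hV, Or.inr ?_⟩
    rw [one_smul, pow_add]; simp only [mul_assoc, one_mul]
  · obtain ⟨c', V', hc', hV', h⟩ := matU_mul_eq hV
    refine ⟨c', i, j + 4 * k, V', hc', hV', Or.inr ?_⟩
    calc matS ε ^ i * matT ε * matS ε ^ j * matU * (matS ε ^ k * V)
        = matS ε ^ i * matT ε * matS ε ^ j * (matU * matS ε ^ k) * V := by simp only [mul_assoc]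
      _ = matS ε ^ i * matT ε * matS ε ^ (j + 4 * k) * (matU * V) := by
          rw [matU_mul_matS_pow hε, pow_add]; simp only [mul_assoc]
      _ = _ := by rw [h, mul_smul_comm]

theorem matT_mul_mem_icosaSet {ε : ℂ} (hε : IsPrimitiveRoot ε 5) {M : Matrix (Fin 2) (Fin 2) ℂ}
    (hM : M ∈ icosaSet ε) : matT ε * M ∈ icosaSet ε := by
  obtain ⟨c, i, j, V, hc, hV, hM⟩ := hM
  rcases hM with rfl | rfl
  · refine ⟨c, 0, i, V, hc, hV, Or.inr ?_⟩
    rw [pow_zero, one_mul, mul_smul_comm, mul_assoc]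
  · rw [mul_smul_comm]
    refine smul_mem_icosaSet ?_ hc
    rw [matS_pow_mod hε i]
    have h2 : matT ε * (matS ε ^ (i % 5) * matT ε * matS ε ^ j * V)
        = matT ε * matS ε ^ (i % 5) * matT ε * (matS ε ^ j * V) := by simp only [mul_assoc]
    rw [h2]
    have hi : i % 5 < 5 := Nat.mod_lt _ (by norm_num)
    generalize i % 5 = k at hi
    interval_cases k
    · rw [pow_zero, mul_one, matT_sq hε]
      exact ⟨-1, j, 0, V, by simp, hV, Or.inl (by simp)⟩
    · rw [matT_mul_matS_mul_matT hε, smul_mul_assoc]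
      exact neg_mem_icosaSet (mul_matS_pow_mem_icosaSet hε _ _ _ hV (by simp))
    · rw [matT_mul_matS_sq_mul_matT hε, one_smul]
      exact mul_matS_pow_mem_icosaSet hε _ _ _ hV (by simp)
    · rw [matT_mul_matS_cube_mul_matT hε, smul_mul_assoc]
      exact neg_mem_icosaSet (mul_matS_pow_mem_icosaSet hε _ _ _ hV (by simp))
    · rw [matT_mul_matS_pow_four_mul_matT hε, one_smul]
      exact mul_matS_pow_mem_icosaSet hε _ _ _ hV (by simp)

/-- The generator `S`. -/
def genS {ε : ℂ} (hε : IsPrimitiveRoot ε 5) : SU2 := ⟨matS ε, matS_mem hε⟩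

/-- The generator `T`. -/
def genT {ε : ℂ} (hε : IsPrimitiveRoot ε 5) : SU2 := ⟨matT ε, matT_mem hε⟩

/-- The generator `U`. -/
def genU : SU2 := ⟨matU, matU_mem⟩

theorem genS_mem {ε : ℂ} (hε : IsPrimitiveRoot ε 5) : genS hε ∈ icosa ε hε :=
  Subgroup.subset_closure (by simp [genS])

theorem genT_mem {ε : ℂ} (hε : IsPrimitiveRoot ε 5) : genT hε ∈ icosa ε hε :=
  Subgroup.subset_closure (by simp [genT])

theorem genU_mem {ε : ℂ} (hε : IsPrimitiveRoot ε 5) : genU ∈ icosa ε hε :=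
  Subgroup.subset_closure (by simp [genU])

theorem pow_mul_mem_of_mul_mem {M : Type*} [Monoid M] {F : Set M} {x : M}
    (h : ∀ y ∈ F, x * y ∈ F) (n : ℕ) {y : M} (hy : y ∈ F) : x ^ n * y ∈ F := by
  induction n with
  | zero => rwa [pow_zero, one_mul]
  | succ n ih => rw [pow_succ', mul_assoc]; exact h _ ih

theorem inv_eq_pow_of_pow_succ_eq_one {G : Type*} [Group G] {x : G} {n : ℕ}
    (h : x ^ (n + 1) = 1) : x⁻¹ = x ^ n :=
  inv_eq_of_mul_eq_one_left (by rw [← pow_succ, h])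

/-- Stability of the list under left multiplication by `S`, `T`, `U` suffices: these have finite
order, so their inverses are powers of them. -/
theorem coe_mem_icosaSet {ε : ℂ} (hε : IsPrimitiveRoot ε 5) {g : SU2} (hg : g ∈ icosa ε hε) :
    (g : Matrix (Fin 2) (Fin 2) ℂ) ∈ icosaSet ε := by
  have hmul : ∀ x ∈ ({⟨matS ε, matS_mem hε⟩, ⟨matT ε, matT_mem hε⟩, ⟨matU, matU_mem⟩} : Set SU2),
      (∀ M ∈ icosaSet ε, (x : Matrix (Fin 2) (Fin 2) ℂ) * M ∈ icosaSet ε) ∧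
        ∃ n : ℕ, x ^ (n + 1) = 1 := by
    have hfour : ∀ M : Matrix (Fin 2) (Fin 2) ℂ, M * M = -1 → M ^ 4 = 1 := fun M h => by
      rw [show 4 = 2 * 2 by norm_num, pow_mul, sq M, h, neg_one_sq]
    rintro x (rfl | rfl | rfl)
    · exact ⟨fun M => matS_mul_mem_icosaSet, 4, Subtype.ext (matS_pow_five hε)⟩
    · exact ⟨fun M => matT_mul_mem_icosaSet hε, 3, Subtype.ext (hfour _ (matT_sq hε))⟩
    · exact ⟨fun M => matU_mul_mem_icosaSet hε, 3, Subtype.ext (hfour _ matU_sq)⟩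
  induction hg using Subgroup.closure_induction_left with
  | one => exact ⟨1, 0, 0, 1, by simp, by simp, Or.inl (by simp)⟩
  | mul_left x hx y _ ih => exact (hmul x hx).1 _ ih
  | inv_mul_cancel x hx y _ ih =>
    obtain ⟨h, n, hn⟩ := hmul x hx
    rw [inv_eq_pow_of_pow_succ_eq_one hn]
    exact pow_mul_mem_of_mul_mem h n ih

instance icosa_finite (ε : ℂ) (hε : IsPrimitiveRoot ε 5) : Finite (icosa ε hε) := by
  have := (icosaSet_finite hε).to_subtype
  refine Finite.of_injective
    (fun g : icosa ε hε => (⟨((g : SU2) : Matrix (Fin 2) (Fin 2) ℂ), coe_mem_icosaSet hε g.2⟩ :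
      icosaSet ε)) fun g h hgh => ?_
  exact Subtype.ext (Subtype.ext (Subtype.mk.inj hgh))

/-! ### Equivariant maps from symmetric powers to `ℂ²` -/

open MvPolynomial in
/-- A linear map that vanishes on the monomials of degree `n` vanishes on `Sⁿ(ℂ²)`. -/
theorem symPow_map_eq_zero {W : Type*} [AddCommGroup W] [Module ℂ W] {n : ℕ}
    (F : MvPolynomial (Fin 2) ℂ →ₗ[ℂ] W)
    (h : ∀ j ≤ n, F (X 0 ^ (n - j) * X 1 ^ j) = 0) {p : MvPolynomial (Fin 2) ℂ}
    (hp : p ∈ SymPow n) : F p = 0 := by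
  rw [mem_homogeneousSubmodule] at hp
  rw [p.as_sum, map_sum]
  refine Finset.sum_eq_zero fun d hd => ?_
  have hdeg : d 0 + d 1 = n := by
    have := hp (mem_support_iff.mp hd)
    rw [Finsupp.weight_apply, Finsupp.sum_fintype _ _ (by simp)] at this
    simpa using this
  have hmon : monomial d (coeff d p) = coeff d p • (X 0 ^ (n - d 1) * X 1 ^ (d 1)) := by
    rw [monomial_eq, Finsupp.prod_fintype _ _ (by simp), Fin.prod_univ_two, smul_eq_C_mul,
      show n - d 1 = d 0 by omega]
  rw [hmon, map_smul, h _ (by omega), smul_zero]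

theorem genS_smul {ε : ℂ} (hε : IsPrimitiveRoot ε 5) (v : C2) :
    (genS hε • v) 0 = ε ^ 3 * v 0 ∧ (genS hε • v) 1 = ε ^ 2 * v 1 := by
  rw [su2_smul_def]
  simp [genS, matS, Matrix.toLpLin_apply, Matrix.vecHead, Matrix.vecTail]

theorem genU_smul (v : C2) : (genU • v) 0 = v 1 ∧ (genU • v) 1 = -v 0 := by
  rw [su2_smul_def]
  simp [genU, matU, Matrix.toLpLin_apply, Matrix.vecHead, Matrix.vecTail]

theorem genT_smul {ε : ℂ} (hε : IsPrimitiveRoot ε 5) (v : C2) :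
    (genT hε • v) 0 = 1 / (ε ^ 2 - ε ^ 3) * ((ε + ε ^ 4) * v 0 + v 1) ∧
      (genT hε • v) 1 = 1 / (ε ^ 2 - ε ^ 3) * (v 0 - (ε + ε ^ 4) * v 1) := by
  rw [su2_smul_def]
  constructor <;> simp [genT, matT, Matrix.toLpLin_apply, Matrix.vecHead, Matrix.vecTail] <;> ring

section Monomials

open MvPolynomial

variable {ε : ℂ} (hε : IsPrimitiveRoot ε 5)

theorem polyAct_genS (m j : ℕ) : polyAct (genS hε) (X 0 ^ m * X 1 ^ j) =
    (ε ^ (3 * m + 2 * j)) • (X 0 ^ m * X 1 ^ j : MvPolynomial (Fin 2) ℂ) := by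
  rw [map_mul, map_pow, map_pow, polyAct_X, polyAct_X]
  simp only [genS, matS, Fin.sum_univ_two, Matrix.of_apply, Matrix.cons_val_zero,
    Matrix.cons_val_one, C_0, zero_mul, add_zero, zero_add, mul_pow, ← C_pow, smul_eq_C_mul,
    pow_add, C_mul, Matrix.cons_val', Matrix.cons_val_fin_one, pow_mul]
  ring

theorem polyAct_genU (m j : ℕ) : polyAct genU (X 0 ^ m * X 1 ^ j) =
    ((-1 : ℂ) ^ m) • (X 0 ^ j * X 1 ^ m : MvPolynomial (Fin 2) ℂ) := by
  rw [map_mul, map_pow, map_pow, polyAct_X, polyAct_X]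
  simp only [genU, matU, Fin.sum_univ_two, Matrix.of_apply, Matrix.cons_val_zero,
    Matrix.cons_val_one, C_0, zero_mul, add_zero, zero_add, smul_eq_C_mul,
    Matrix.cons_val', Matrix.cons_val_fin_one, mul_pow, ← C_pow, one_pow, C_1]
  ring

theorem polyAct_genT (n : ℕ) : polyAct (genT hε) (X 0 ^ n) =
    ((1 / (ε ^ 2 - ε ^ 3)) ^ n) • ∑ j ∈ Finset.range (n + 1),
      ((ε + ε ^ 4) ^ (n - j) * (n.choose j : ℂ)) •
        (X 0 ^ (n - j) * X 1 ^ j : MvPolynomial (Fin 2) ℂ) := by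
  have h : polyAct (genT hε) (X 0) =
      C (1 / (ε ^ 2 - ε ^ 3)) * (X 1 + C (ε + ε ^ 4) * X 0) := by
    rw [polyAct_X]
    simp only [genT, matT, Fin.sum_univ_two, Matrix.smul_apply, Matrix.of_apply,
      Matrix.cons_val_zero, Matrix.cons_val_one, Matrix.cons_val', Matrix.cons_val_fin_one,
      smul_eq_mul, C_mul, C_1]
    ring
  rw [map_pow, h, mul_pow, add_pow, smul_eq_C_mul, C_pow]
  congr 1
  refine Finset.sum_congr rfl fun j _ => ?_
  rw [smul_eq_C_mul, C_mul, C_pow, mul_pow, map_natCast]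
  ring

end Monomials

section Intertwiners

open MvPolynomial

variable {ε : ℂ} (hε : IsPrimitiveRoot ε 5)

-- Vectors of different `S`-weights: the eigenvalues `ε ^ w` and `ε ^ r` are distinct, so a
-- component having both must vanish.
include hε in
theorem eq_zero_of_pow_mul_eq {w r : ℕ} (hr : r < 5) (hw : w % 5 ≠ r) {x : ℂ}
    (h : ε ^ w * x = ε ^ r * x) : x = 0 := by
  by_contra hx
  have h1 : ε ^ (w % 5) = ε ^ r := by
    rw [← pow_eq_pow_mod w hε.pow_eq_one]
    exact mul_right_cancel₀ hx h
  exact hw (hε.pow_inj (Nat.mod_lt _ (by norm_num)) hr h1)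

include hε in
theorem add_pow_four_ne_zero : ε + ε ^ 4 ≠ 0 := fun h => by
  have hs := root_sum hε
  have h5 : ε ^ 5 = 1 := hε.pow_eq_one
  have h1 : (ε + ε ^ 4) ^ 2 + (ε + ε ^ 4) = 1 := by linear_combination (ε ^ 3 + 2) * h5 + hs
  rw [h] at h1
  norm_num at h1

/-- The linear system left over for `n = 9`, with `a = ε + ε⁴`, `δ = 1 / (ε² - ε³)` and `126 =
C(9,4)`. Since `(a - 2)² = 5a²`, the factor `δ⁸` equals `1 / (25a⁴)`, and everything takes place in
`ℤ[a]` with `a² = 1 - a`. -/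
theorem eq_zero_of_golden {a δ c d : ℂ} (ha : a ^ 2 = 1 - a) (hδ : δ ^ 2 * (a - 2) = 1)
    (h0 : δ * -d = δ ^ 9 * (126 * a ^ 5 * c + d))
    (h1 : δ * (a * d) = δ ^ 9 * (126 * a ^ 4 * c - a ^ 9 * d)) : c = 0 ∧ d = 0 := by
  have hδ0 : δ ≠ 0 := by rintro rfl; norm_num at hδ
  have ha0 : a ≠ 0 := by rintro rfl; norm_num at ha
  have a4 : a ^ 4 = 2 - 3 * a := by linear_combination (a ^ 2 - a + 2) * ha
  have a5 : a ^ 5 = 5 * a - 3 := by linear_combination a * a4 - 3 * ha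
  have a9 : a ^ 9 = 34 * a - 21 := by
    linear_combination a ^ 5 * a4 + (2 - 3 * a) * a5 - 15 * ha
  have h8 : δ ^ 8 * (25 * a ^ 4) = 1 := by
    have h : (a - 2) ^ 4 = 25 * a ^ 4 := by
      rw [a4]; linear_combination a4 + (-8 * a + 32) * ha
    rw [← h]
    linear_combination ((δ ^ 2 * (a - 2)) ^ 3 + (δ ^ 2 * (a - 2)) ^ 2 + δ ^ 2 * (a - 2) + 1) * hδ
  have e0 : -d = δ ^ 8 * (126 * a ^ 5 * c + d) :=
    mul_left_cancel₀ hδ0 (by linear_combination h0)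
  have e1 : a * d = δ ^ 8 * (126 * a ^ 4 * c - a ^ 9 * d) :=
    mul_left_cancel₀ hδ0 (by linear_combination h1)
  have f0 : 25 * a ^ 4 * -d = 126 * a ^ 5 * c + d := by
    linear_combination 25 * a ^ 4 * e0 + (126 * a ^ 5 * c + d) * h8
  have f1 : 25 * a ^ 4 * (a * d) = 126 * a ^ 4 * c - a ^ 9 * d := by
    linear_combination 25 * a ^ 4 * e1 + (126 * a ^ 4 * c - a ^ 9 * d) * h8
  have hd : d = 0 := by
    -- Eliminating `c` gives `(a¹⁰ + 25a⁶ + 25a⁴ + 1) d = 0`, and the factor reduces to `30(7 -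
    -- 11a)`. Its conjugate `18 + 11a` then yields the norm `(7 - 11a)(18 + 11a) = 5`.
    have h2 : (7 - 11 * a) * d = 0 := by
      grind
    have h3 : 5 * d = 0 := by linear_combination (18 + 11 * a) * h2 + 121 * d * ha
    simpa using h3
  refine ⟨?_, hd⟩
  rw [hd] at f0
  have h4 : a ^ 5 * c = 0 := by linear_combination -(1 / 126) * f0
  exact (mul_eq_zero.mp h4).resolve_left (pow_ne_zero 5 ha0)

/-- There is no nonzero linear map `Sⁿ(ℂ²) → ℂ²` that is equivariant under the generators of the
binary icosahedral group, if `n` is `3`, `5`, `7` or `9`. -/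
theorem symPow_equivariant_eq_zero {n : ℕ} (hn : n = 3 ∨ n = 5 ∨ n = 7 ∨ n = 9)
    (F : SymPow n →ₗ[ℂ] C2) (hF : ∀ g ∈ icosa ε hε, ∀ p, F (symRep n g p) = g • F p) : F = 0 := by
  -- The extension to all polynomials is merely linear; it lets monomials be inserted without
  -- membership proofs.
  obtain ⟨F', hF'⟩ := LinearMap.exists_extend F
  have hact : ∀ g ∈ icosa ε hε, ∀ p ∈ SymPow n, F' (polyAct g p) = g • F' p := by
    intro g hg p hp
    have h := hF g hg ⟨p, hp⟩
    rw [← hF'] at h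
    exact h
  have hmem : ∀ j ≤ n, (X 0 ^ (n - j) * X 1 ^ j : MvPolynomial (Fin 2) ℂ) ∈ SymPow n := by
    intro j hj
    have h := ((isHomogeneous_X ℂ (0 : Fin 2)).pow (n - j)).mul
      ((isHomogeneous_X ℂ (1 : Fin 2)).pow j)
    rw [mem_homogeneousSubmodule]
    convert h using 1
    omega
  let f : ℕ → C2 := fun j => F' (X 0 ^ (n - j) * X 1 ^ j)
  -- Under `S` the variables have weights 3 and 2, and the first coordinate of `ℂ²` has weight 3.
  have hS : ∀ j ≤ n, (3 * (n - j) + 2 * j) % 5 ≠ 3 → f j 0 = 0 := by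
    intro j hj hw
    have h := hact _ (genS_mem hε) _ (hmem j hj)
    rw [polyAct_genS, map_smul] at h
    have h0 := congrArg (fun v : C2 => v 0) h
    simp only [(genS_smul hε _).1, PiLp.smul_apply, smul_eq_mul] at h0
    exact eq_zero_of_pow_mul_eq hε (by norm_num) hw h0
  -- `U` swaps the variables up to sign, so the first coordinates determine the second ones.
  have hU : ∀ j ≤ n, f j 1 = (-1) ^ (n - j) * f (n - j) 0 := by
    intro j hj
    have h := hact _ (genU_mem hε) _ (hmem j hj)
    rw [polyAct_genU, map_smul] at h
    have h0 := congrArg (fun v : C2 => v 0) h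
    simp only [(genU_smul _).1, PiLp.smul_apply, smul_eq_mul] at h0
    rw [← h0, show j = n - (n - j) by omega]
    simp only [f, show n - (n - (n - j)) = n - j by omega]
  -- The only use of `T`: its action on `X 0 ^ n`, expanded by the binomial theorem.
  have hT := hact _ (genT_mem hε) _ (hmem 0 n.zero_le)
  rw [pow_zero, mul_one, Nat.sub_zero, polyAct_genT, map_smul, map_sum] at hT
  simp only [map_smul] at hT
  have hf0 : F' (X 0 ^ n) = f 0 := by simp [f]
  change _ • ∑ j ∈ Finset.range (n + 1), _ • f j = _ at hT
  rw [hf0] at hT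
  have hT0 := congrArg (fun v : C2 => v 0) hT
  have hT1 := congrArg (fun v : C2 => v 1) hT
  simp only [(genT_smul hε _).1, (genT_smul hε _).2, PiLp.smul_apply, smul_eq_mul,
    WithLp.ofLp_sum, Finset.sum_apply, WithLp.ofLp_smul, Pi.smul_apply] at hT0 hT1
  have hd := mul_one_div_cancel (root_diff_ne_zero hε)
  have ha := add_pow_four_ne_zero hε
  have hz : ∀ j ≤ n, f j 0 = 0 := by
    have hδ0 : 1 / (ε ^ 2 - ε ^ 3) ≠ 0 := one_div_ne_zero (root_diff_ne_zero hε)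
    -- If one inner index `m` alone has weight 3, then `f 0` is zero and the equation for `T`
    -- retains only a nonzero multiple of `f m 0`.
    have hsingle : ∀ m, 0 < m → m < n → (∀ j ≤ n, j ≠ m → (3 * (n - j) + 2 * j) % 5 ≠ 3) →
        ∀ j ≤ n, f j 0 = 0 := by
      intro m hm0 hmn hm j hj
      have h00 : f 0 0 = 0 := hS 0 n.zero_le (hm 0 n.zero_le hm0.ne)
      have h01 : f 0 1 = 0 := by
        rw [hU 0 n.zero_le, Nat.sub_zero, hS n le_rfl (hm n le_rfl hmn.ne'), mul_zero]
      rw [Finset.sum_eq_single m, h00, h01] at hT0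
      · by_cases hjm : j = m
        · have hc : (n.choose m : ℂ) ≠ 0 := Nat.cast_ne_zero.mpr (Nat.choose_pos hmn.le).ne'
          rw [mul_zero, add_zero, mul_zero, mul_eq_zero, mul_eq_zero, mul_eq_zero] at hT0
          rw [hjm]
          exact ((hT0.resolve_left (pow_ne_zero _ hδ0)).resolve_left
            (not_or.mpr ⟨pow_ne_zero _ ha, hc⟩))
        · exact hS j hj (hm j hj hjm)
      · intro i hi him
        have hi' : i ≤ n := Nat.lt_succ_iff.mp (Finset.mem_range.mp hi)
        rw [hS i hi' (hm i hi' him), mul_zero]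
      · intro h
        exact absurd (Finset.mem_range.mpr (by omega)) h
    rcases hn with rfl | rfl | rfl | rfl
    · exact hsingle 1 (by norm_num) (by norm_num) (by decide)
    · exact hsingle 2 (by norm_num) (by norm_num) (by decide)
    · exact hsingle 3 (by norm_num) (by norm_num) (by decide)
    -- For `n = 9` the indices 4 and 9 both have weight 3, so both coordinates of the equation for
    -- `T` are needed.
    · have hu : ∀ j ≤ 9, (3 * j + 2 * (9 - j)) % 5 ≠ 3 → f j 1 = 0 := by
        intro j hj hw
        rw [hU j hj, hS (9 - j) (by omega) (by rwa [Nat.sub_sub_self hj]), mul_zero]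
      have h01 : f 0 1 = -f 9 0 := by rw [hU 0 (by norm_num)]; norm_num
      have h51 : f 5 1 = f 4 0 := by rw [hU 5 (by norm_num)]; norm_num
      have hs : ∀ g : ℕ → ℂ, (∀ j ≤ 9, j ≠ 4 → j ≠ 9 → g j = 0) →
          ∑ j ∈ Finset.range (9 + 1), g j = g 4 + g 9 := by
        intro g hg
        simp [Finset.sum_range_succ, hg]
      have hs' : ∀ g : ℕ → ℂ, (∀ j ≤ 9, j ≠ 0 → j ≠ 5 → g j = 0) →
          ∑ j ∈ Finset.range (9 + 1), g j = g 0 + g 5 := by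
        intro g hg
        simp [Finset.sum_range_succ, hg]
      have hS' : ∀ j ≤ 9, j ≠ 4 → j ≠ 9 → f j 0 = 0 := fun j hj h4 h9 =>
        hS j hj (by clear * - hj h4 h9; omega)
      have hu' : ∀ j ≤ 9, j ≠ 0 → j ≠ 5 → f j 1 = 0 := fun j hj h4 h9 =>
        hu j hj (by clear * - hj h4 h9; omega)
      rw [hs _ fun j hj h4 h9 => by rw [hS' j hj h4 h9, mul_zero], hS' 0 (by norm_num) (by norm_num)
        (by norm_num), h01] at hT0
      rw [hs' _ fun j hj h4 h9 => by rw [hu' j hj h4 h9, mul_zero], hS' 0 (by norm_num) (by norm_num)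
        (by norm_num), h01, h51] at hT1
      have h5 : ε ^ 5 = 1 := hε.pow_eq_one
      have hsum := root_sum hε
      have hgold : (ε + ε ^ 4) ^ 2 = 1 - (ε + ε ^ 4) := by
        linear_combination (ε ^ 3 + 2) * h5 + hsum
      have hdelta : (1 / (ε ^ 2 - ε ^ 3)) ^ 2 * (ε + ε ^ 4 - 2) = 1 := by
        have h : (ε ^ 2 - ε ^ 3) ^ 2 = ε + ε ^ 4 - 2 := by linear_combination (ε - 2) * h5
        rw [← h, ← mul_pow, mul_comm, hd, one_pow]
      obtain ⟨h4, h9⟩ := eq_zero_of_golden (c := f 4 0) (d := f 9 0) hgold hdelta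
        (by norm_num [Nat.choose] at hT0 ⊢; linear_combination -hT0)
        (by norm_num [Nat.choose] at hT1 ⊢; linear_combination -hT1)
      intro j hj
      by_cases hj4 : j = 4
      · rw [hj4, h4]
      by_cases hj9 : j = 9
      · rw [hj9, h9]
      exact hS' j hj hj4 hj9
  have hfz : ∀ j ≤ n, f j = 0 := by
    intro j hj
    ext i
    fin_cases i
    · exact hz j hj
    · change f j 1 = 0
      rw [hU j hj, hz _ (Nat.sub_le _ _), mul_zero]
  refine LinearMap.ext fun p => ?_
  rw [← hF']
  exact symPow_map_eq_zero F' hfz p.2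

end Intertwiners

/-! ### Continuous sections as classes of `L²`-sections -/

/-- Ensures that a continuous section is determined by its `L²`-class. The vectors over a nonempty
open set form an open set stable under scaling, which therefore meets the unit ball. -/
instance : invMeasure.IsOpenPosMeasure := by
  refine ⟨fun U hU hne => ?_⟩
  have hs : MeasurableSet {v : C2 | v ≠ 0} := (measurableSet_singleton (0 : C2)).compl
  have he : MeasurableEmbedding (Subtype.val : {v : C2 // v ≠ 0} → C2) :=
    MeasurableEmbedding.subtype_coe hs
  have hV : IsOpen ((Subtype.val : {v : C2 // v ≠ 0} → C2) ''
      ((fun v : {v : C2 // v ≠ 0} => Projectivization.mk ℂ v.1 v.2) ⁻¹' U)) :=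
    (isOpen_compl_singleton (x := (0 : C2))).isOpenMap_subtype_val _ (hU.preimage continuous_mk)
  rw [invMeasure, Measure.map_apply continuous_mk.measurable hU.measurableSet, he.comap_apply,
    Measure.restrict_apply hV.measurableSet]
  refine ((hV.inter Metric.isOpen_ball).measure_pos volume ?_).ne'
  obtain ⟨l, hl⟩ := hne
  induction l using Projectivization.ind with
  | h v hv =>
    have hn : (0 : ℝ) < ‖v‖ := norm_pos_iff.mpr hv
    have hc : ((2 * ‖v‖ : ℝ) : ℂ)⁻¹ ≠ 0 :=
      inv_ne_zero (Complex.ofReal_ne_zero.mpr (by positivity))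
    have hw : ((2 * ‖v‖ : ℝ) : ℂ)⁻¹ • v ≠ 0 := smul_ne_zero hc hv
    refine ⟨((2 * ‖v‖ : ℝ) : ℂ)⁻¹ • v, ⟨⟨_, hw⟩, ?_, rfl⟩, ?_⟩
    · have h : Projectivization.mk ℂ _ hw = Projectivization.mk ℂ v hv :=
        (Projectivization.mk_eq_mk_iff' ℂ _ _ hw hv).mpr ⟨_, rfl⟩
      rw [Set.mem_preimage, h]
      exact hl
    · rw [mem_ball_zero_iff, norm_smul, norm_inv, Complex.norm_real, Real.norm_of_nonneg
        (by positivity), mul_inv, mul_assoc, inv_mul_cancel₀ hn.ne']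
      norm_num

theorem contSections_eq_of_ae_eq {s t : ContSections}
    (h : (s : CP1 → C2) =ᵐ[invMeasure] (t : CP1 → C2)) : s = t :=
  Subtype.ext ((Continuous.ae_eq_iff_eq invMeasure s.2.1 t.2.1).mp h)

/-- The class of an element of `Γ^{2k}` in the space of `L²`-sections. -/
def gamToL2 (k : ℕ) : Gam k →ₗ[ℂ] L2Sections where
  toFun s := s.2.choose
  map_add' s t := by
    refine Subtype.ext (Lp.ext ?_)
    exact (s + t).2.choose_spec.2.trans
      ((s.2.choose_spec.2.add t.2.choose_spec.2).symm.trans (Lp.coeFn_add _ _).symm)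
  map_smul' c s := by
    refine Subtype.ext (Lp.ext ?_)
    exact (c • s).2.choose_spec.2.trans
      ((s.2.choose_spec.2.const_smul c).symm.trans (Lp.coeFn_smul _ _).symm)

theorem gamToL2_sub (k : ℕ) (s t : Gam k) : gamToL2 k (s - t) = gamToL2 k s - gamToL2 k t :=
  LinearMap.map_sub (gamToL2 k) s t

theorem gamToL2_neg (k : ℕ) (s : Gam k) : gamToL2 k (-s) = -gamToL2 k s :=
  LinearMap.map_neg (gamToL2 k) s

theorem gamToL2_ae (k : ℕ) (s : Gam k) :
    ((gamToL2 k s : Lp C2 2 invMeasure) : CP1 → C2) =ᵐ[invMeasure] ((s : ContSections) : CP1 → C2) :=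
  s.2.choose_spec.2

theorem gamToL2_mem (k : ℕ) (s : Gam k) : gamToL2 k s ∈ l2Isotypic (2 * k - 1) :=
  s.2.choose_spec.1

theorem gamToL2_injective (k : ℕ) : Function.Injective (gamToL2 k) := fun s t h => by
  refine Subtype.ext (contSections_eq_of_ae_eq ?_)
  have h1 := gamToL2_ae k s
  rw [h] at h1
  exact h1.symm.trans (gamToL2_ae k t)

theorem gamToL2_equivariant (k : ℕ) (g : SU2) (s : Gam k) :
    gamToL2 k (gamRep k g s) = l2Rep g (gamToL2 k s) := by
  refine Subtype.ext (Lp.ext ?_)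
  filter_upwards [gamToL2_ae k (gamRep k g s), coeFn_lpAct g (gamToL2 k s : Lp C2 2 invMeasure),
    (measurePreserving_su2 g⁻¹).quasiMeasurePreserving.ae (gamToL2_ae k s)] with l h1 h2 h3
  refine h1.trans (Eq.trans ?_ h2.symm)
  rw [h3]
  rfl

/-! ### The sections in `Γ²` -/

/-- The standard basis of `S¹(ℂ²)`. -/
def symX (j : Fin 2) : SymPow 1 :=
  ⟨MvPolynomial.X j, (MvPolynomial.mem_homogeneousSubmodule _ _).mpr
    (MvPolynomial.isHomogeneous_X ℂ j)⟩

theorem symRep_symX (g : SU2) (j : Fin 2) :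
    symRep 1 g (symX j) = (g : Matrix (Fin 2) (Fin 2) ℂ) 0 j • symX 0 +
      (g : Matrix (Fin 2) (Fin 2) ℂ) 1 j • symX 1 := by
  refine Subtype.ext ?_
  change polyAct g (MvPolynomial.X j) = _
  rw [polyAct_X, Fin.sum_univ_two, ← MvPolynomial.smul_eq_C_mul, ← MvPolynomial.smul_eq_C_mul]
  rfl

theorem symPow_one_eq (p : SymPow 1) : ∃ a b : ℂ, p = a • symX 0 + b • symX 1 := by
  by_contra hp
  have hN : p.1 ∉ Submodule.span ℂ {(symX 0).1, (symX 1).1} := by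
    rw [Submodule.mem_span_pair]
    rintro ⟨a, b, h⟩
    exact hp ⟨a, b, Subtype.ext h.symm⟩
  refine hN ?_
  rw [← Submodule.Quotient.mk_eq_zero]
  refine symPow_map_eq_zero (Submodule.mkQ _) (fun j hj => ?_) p.2
  rw [Submodule.mkQ_apply, Submodule.Quotient.mk_eq_zero]
  interval_cases j
  · exact Submodule.subset_span (by simp [symX])
  · exact Submodule.subset_span (by simp [symX])

/-- Intertwiners can be added and scaled, so all terms `φ(a x₀ + b x₁)` collect into two
intertwiners, each evaluated at one basis vector. -/
theorem l2Isotypic_one_eq {f : L2Sections} (hf : f ∈ l2Isotypic 1) :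
    ∃ φ φ' : (symRep 1).IntertwiningMap l2Rep, f = φ (symX 0) + φ' (symX 1) := by
  refine Submodule.iSup_induction _ (motive := fun f => ∃ φ φ' : (symRep 1).IntertwiningMap l2Rep,
    f = φ (symX 0) + φ' (symX 1)) hf ?_ ?_ ?_
  · rintro φ _ ⟨p, rfl⟩
    obtain ⟨a, b, rfl⟩ := symPow_one_eq p
    exact ⟨a • φ, b • φ, by rw [map_add, map_smul, map_smul]; rfl⟩
  · exact ⟨0, 0, by simp⟩
  · rintro _ _ ⟨φ, φ', rfl⟩ ⟨ψ, ψ', rfl⟩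
    refine ⟨φ + ψ, φ' + ψ', ?_⟩
    simp only [Representation.IntertwiningMap.coe_add, Pi.add_apply]
    abel

/-- Transitivity on the unit sphere: `u` is completed by an orthonormal second column that makes the
determinant 1. -/
theorem exists_su2_smul_eq (u : C2) (hu : ‖u‖ = 1) : ∃ g : SU2,
    g • (EuclideanSpace.single 0 1 : C2) = u ∧
      ∀ j, (g : Matrix (Fin 2) (Fin 2) ℂ) j 0 = u j := by
  have h1 : u 0 * starRingEnd ℂ (u 0) + u 1 * starRingEnd ℂ (u 1) = 1 := by
    have h := EuclideanSpace.norm_sq_eq u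
    rw [hu, Fin.sum_univ_two] at h
    simp only [Complex.mul_conj, Complex.normSq_eq_norm_sq]
    rw [← Complex.ofReal_add, ← h, one_pow, Complex.ofReal_one]
  have hg : !![u 0, -starRingEnd ℂ (u 1); u 1, starRingEnd ℂ (u 0)] ∈
      Matrix.specialUnitaryGroup (Fin 2) ℂ := by
    rw [Matrix.mem_specialUnitaryGroup_iff, Matrix.mem_unitaryGroup_iff]
    constructor
    · ext i j
      fin_cases i <;> fin_cases j <;>
        simp [Matrix.mul_apply, Fin.sum_univ_two, Matrix.star_apply] <;>
        first | ring1 | linear_combination h1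
    · simp [Matrix.det_fin_two]
      linear_combination h1
  refine ⟨⟨_, hg⟩, ?_, fun j => ?_⟩
  · rw [su2_smul_def]
    ext j
    fin_cases j <;> simp [Matrix.toLpLin_apply]
  · fin_cases j <;> rfl

theorem coe_inv_su2 (g : SU2) (i j : Fin 2) : ((g⁻¹ : SU2) : Matrix (Fin 2) (Fin 2) ℂ) i j =
    starRingEnd ℂ ((g : Matrix (Fin 2) (Fin 2) ℂ) j i) := rfl

theorem single_zero_ne_zero : (EuclideanSpace.single 0 1 : C2) ≠ 0 := by
  simp

/-- Sections that transform like the standard basis of `ℂ²` are multiples of the projections of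
the basis vectors to the fibres. -/
theorem eval_of_contRep_eq {ε : ℂ} (hε : IsPrimitiveRoot ε 5) (s : Fin 2 → ContSections)
    (hs : ∀ g j, contRep g (s j) = (g : Matrix (Fin 2) (Fin 2) ℂ) 0 j • s 0 +
      (g : Matrix (Fin 2) (Fin 2) ℂ) 1 j • s 1) :
    ∃ c : ℂ, ∀ (j : Fin 2) (u : C2) (hu : u ≠ 0), ‖u‖ = 1 →
      (s j : CP1 → C2) (Projectivization.mk ℂ u hu) = (c * starRingEnd ℂ (u j)) • u := by
  set e : C2 := EuclideanSpace.single 0 1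
  set l : CP1 := Projectivization.mk ℂ e single_zero_ne_zero with hl
  have hmem : ∀ j, ∃ c : ℂ, c • e = (s j : CP1 → C2) l := fun j => by
    have h := (s j).2.2 l
    rwa [hl, Projectivization.submodule_mk, Submodule.mem_span_singleton] at h
  obtain ⟨c, hc⟩ := hmem 0
  obtain ⟨d, hd⟩ := hmem 1
  have hSe : genS hε • e = ε ^ 3 • e := by
    ext i
    fin_cases i
    · exact (genS_smul hε e).1
    · refine (genS_smul hε e).2.trans ?_
      simp [e]
  have hSl : (genS hε)⁻¹ • l = l := by
    rw [inv_smul_eq_iff, hl, Projectivization.smul_mk]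
    refine ((Projectivization.mk_eq_mk_iff' ℂ _ _ _ _).mpr ⟨ε ^ 3, ?_⟩).symm
    exact hSe.symm
  -- `S` fixes the line `l` and acts on its fibre by `ε³`, whereas `s 1` is an `S`-eigenvector for
  -- `ε²`.
  have hd0 : d = 0 := by
    have h := congrArg (fun t : ContSections => (t : CP1 → C2) l) (hs (genS hε) 1)
    simp only [contRep_apply] at h
    rw [hSl, ← hd] at h
    have h2 : ((((genS hε : SU2) : Matrix (Fin 2) (Fin 2) ℂ) 0 1 • s 0 +
        ((genS hε : SU2) : Matrix (Fin 2) (Fin 2) ℂ) 1 1 • s 1 : ContSections) : CP1 → C2) l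
        = ε ^ 2 • d • e := by
      change (matS ε) 0 1 • (s 0 : CP1 → C2) l + (matS ε) 1 1 • (s 1 : CP1 → C2) l = _
      rw [← hd]
      simp [matS]
    rw [h2, smul_comm, hSe] at h
    have h3 := congrArg (fun v : C2 => v 0) h
    simp only [e, PiLp.smul_apply, PiLp.single_apply, if_true, smul_eq_mul, mul_one] at h3
    have h4 : (ε ^ 2 - ε ^ 3) * d = 0 := by linear_combination -h3
    exact (mul_eq_zero.mp h4).resolve_left (root_diff_ne_zero hε)
  refine ⟨c, fun j u hu hu1 => ?_⟩
  -- With `u = g e`, the transformation rule for `g⁻¹` at `l` gives the value at `[u]`; the factor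
  -- `conj (u j)` is the entry `(g⁻¹)_{0j}`.
  obtain ⟨g, hg, hgj⟩ := exists_su2_smul_eq u hu1
  have hgl : g • l = Projectivization.mk ℂ u hu := by
    rw [hl, Projectivization.smul_mk]
    congr 1
  have h := congrArg (fun t : ContSections => (t : CP1 → C2) l) (hs g⁻¹ j)
  simp only [contRep_apply, inv_inv, hgl] at h
  rw [inv_smul_eq_iff] at h
  rw [h]
  change g • (((g⁻¹ : SU2) : Matrix (Fin 2) (Fin 2) ℂ) 0 j • (s 0 : CP1 → C2) l +
    ((g⁻¹ : SU2) : Matrix (Fin 2) (Fin 2) ℂ) 1 j • (s 1 : CP1 → C2) l) = _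
  rw [← hc, ← hd, hd0, zero_smul, smul_zero, add_zero, smul_comm, smul_comm g, hg, coe_inv_su2, hgj,
    smul_smul, mul_comm]

theorem contRep_eq_of_gamToL2_eq (φ : (symRep 1).IntertwiningMap l2Rep) (s : Fin 2 → Gam 1)
    (hs : ∀ j, gamToL2 1 (s j) = φ (symX j)) (g : SU2) (j : Fin 2) :
    contRep g (s j) = (g : Matrix (Fin 2) (Fin 2) ℂ) 0 j • (s 0 : ContSections) +
      (g : Matrix (Fin 2) (Fin 2) ℂ) 1 j • (s 1 : ContSections) := by
  have h : gamRep 1 g (s j) = (g : Matrix (Fin 2) (Fin 2) ℂ) 0 j • s 0 +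
      (g : Matrix (Fin 2) (Fin 2) ℂ) 1 j • s 1 := by
    apply gamToL2_injective
    rw [gamToL2_equivariant, map_add, map_smul, map_smul, hs, hs, hs, ← φ.isIntertwining,
      symRep_symX, map_add, map_smul, map_smul]
  exact congrArg Subtype.val h

/-- Every section in `Γ²` is the projection of a fixed vector of `ℂ²` to the fibres. -/
theorem gam_one_eval {ε : ℂ} (hε : IsPrimitiveRoot ε 5) (s : Gam 1) :
    ∃ w : C2, ∀ (u : C2) (hu : u ≠ 0), ‖u‖ = 1 →
      ((s : ContSections) : CP1 → C2) (Projectivization.mk ℂ u hu) = inner ℂ u w • u := by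
  obtain ⟨φ, φ', hf⟩ := l2Isotypic_one_eq (gamToL2_mem 1 s)
  have hx : l2Rep (genS hε) (φ (symX 0)) = ε ^ 3 • φ (symX 0) := by
    rw [← φ.isIntertwining, symRep_symX, map_add, map_smul, map_smul]
    simp [genS, matS]
  have hy : l2Rep (genS hε) (φ' (symX 1)) = ε ^ 2 • φ' (symX 1) := by
    rw [← φ'.isIntertwining, symRep_symX, map_add, map_smul, map_smul]
    simp [genS, matS]
  have hUx : l2Rep genU (φ (symX 0)) = -φ (symX 1) := by
    rw [← φ.isIntertwining, symRep_symX, map_add, map_smul, map_smul]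
    simp [genU, matU]
  have hUy : l2Rep genU (φ' (symX 1)) = φ' (symX 0) := by
    rw [← φ'.isIntertwining, symRep_symX, map_add, map_smul, map_smul]
    simp [genU, matU]
  have hd : ε ^ 3 - ε ^ 2 ≠ 0 := fun h => root_diff_ne_zero hε (by linear_combination -h)
  -- A priori `φ(x₀)` is only an `L²`-class. Projecting `s` to the `ε³`-eigenspace of `S` inside
  -- `Γ²` provides a continuous representative.
  let a : Gam 1 := (ε ^ 3 - ε ^ 2)⁻¹ • (gamRep 1 (genS hε) s - ε ^ 2 • s)
  have ha : gamToL2 1 a = φ (symX 0) := by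
    rw [map_smul, gamToL2_sub, map_smul, gamToL2_equivariant, hf, map_add, hx, hy, smul_add,
      add_sub_add_right_eq_sub, ← sub_smul, inv_smul_smul₀ hd]
  have hb : gamToL2 1 (s - a) = φ' (symX 1) := by
    rw [gamToL2_sub, ha, hf, add_sub_cancel_left]
  -- Since `U x₀ = -x₁`, the section `-U a` represents `φ(x₁)`, and the pair transforms like the
  -- standard basis.
  obtain ⟨c, hc⟩ := eval_of_contRep_eq hε (fun j => (![a, -gamRep 1 genU a] j : Gam 1))
    (contRep_eq_of_gamToL2_eq φ _ fun j => by
      fin_cases j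
      · exact ha
      · change gamToL2 1 (-gamRep 1 genU a) = _
        rw [gamToL2_neg, gamToL2_equivariant, ha, hUx, neg_neg]
        rfl)
  obtain ⟨c', hc'⟩ := eval_of_contRep_eq hε (fun j => (![gamRep 1 genU (s - a), s - a] j : Gam 1))
    (contRep_eq_of_gamToL2_eq φ' _ fun j => by
      fin_cases j
      · change gamToL2 1 (gamRep 1 genU (s - a)) = _
        rw [gamToL2_equivariant, hb, hUy]
        rfl
      · exact hb)
  refine ⟨!₂[c, c'], fun u hu hu1 => ?_⟩
  have h0 : ((a : ContSections) : CP1 → C2) (Projectivization.mk ℂ u hu) = _ := hc 0 u hu hu1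
  have h1 : (((s - a : Gam 1) : ContSections) : CP1 → C2) (Projectivization.mk ℂ u hu) = _ :=
    hc' 1 u hu hu1
  have h2 : ((s : ContSections) : CP1 → C2) (Projectivization.mk ℂ u hu) =
      ((a : ContSections) : CP1 → C2) (Projectivization.mk ℂ u hu) +
      (((s - a : Gam 1) : ContSections) : CP1 → C2) (Projectivization.mk ℂ u hu) := by
    have h3 : s = a + (s - a) := (add_sub_cancel a s).symm
    nth_rewrite 1 [h3]
    rfl
  rw [h2, h0, h1, ← add_smul]
  congr 1
  simp [PiLp.inner_apply, Fin.sum_univ_two]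

theorem single_one_ne_zero : (EuclideanSpace.single 1 1 : C2) ≠ 0 := by
  simp

/-- The vector of `ℂ²` whose projections to the fibres are the values of a section in `Γ²`. -/
def gamVec : Gam 1 →ₗ[ℂ] C2 where
  toFun s := ((s : ContSections) : CP1 → C2) (Projectivization.mk ℂ _ single_zero_ne_zero) +
    ((s : ContSections) : CP1 → C2) (Projectivization.mk ℂ _ single_one_ne_zero)
  map_add' _ _ := add_add_add_comm _ _ _ _
  map_smul' c _ := (smul_add c _ _).symm

theorem gamVec_eq {s : Gam 1} {w : C2} (h : ∀ (u : C2) (hu : u ≠ 0), ‖u‖ = 1 →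
    ((s : ContSections) : CP1 → C2) (Projectivization.mk ℂ u hu) = inner ℂ u w • u) :
    gamVec s = w := by
  change ((s : ContSections) : CP1 → C2) (Projectivization.mk ℂ _ single_zero_ne_zero) +
    ((s : ContSections) : CP1 → C2) (Projectivization.mk ℂ _ single_one_ne_zero) = w
  rw [h _ _ (by simp), h _ _ (by simp)]
  ext i
  fin_cases i <;> simp [EuclideanSpace.inner_single_left]

theorem gamVec_eval {ε : ℂ} (hε : IsPrimitiveRoot ε 5) (s : Gam 1) (u : C2) (hu : u ≠ 0)
    (hu1 : ‖u‖ = 1) :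
    ((s : ContSections) : CP1 → C2) (Projectivization.mk ℂ u hu) = inner ℂ u (gamVec s) • u := by
  obtain ⟨w, hw⟩ := gam_one_eval hε s
  rw [gamVec_eq hw]
  exact hw u hu hu1

theorem gamVec_injective {ε : ℂ} (hε : IsPrimitiveRoot ε 5) : Function.Injective gamVec := by
  intro s t hst
  refine Subtype.ext (Subtype.ext (funext fun l => ?_))
  induction l using Projectivization.ind with
  | h v hv =>
    have hn : (‖v‖ : ℂ)⁻¹ ≠ 0 := inv_ne_zero (Complex.ofReal_ne_zero.mpr (norm_ne_zero_iff.mpr hv))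
    have hw : (‖v‖ : ℂ)⁻¹ • v ≠ 0 := smul_ne_zero hn hv
    have hw1 : ‖(‖v‖ : ℂ)⁻¹ • v‖ = 1 := norm_smul_inv_norm hv
    have h : Projectivization.mk ℂ v hv = Projectivization.mk ℂ _ hw :=
      ((Projectivization.mk_eq_mk_iff' ℂ _ _ hw hv).mpr ⟨_, rfl⟩).symm
    rw [h, gamVec_eval hε s _ hw hw1, gamVec_eval hε t _ hw hw1, hst]

theorem gamVec_equivariant {ε : ℂ} (hε : IsPrimitiveRoot ε 5) (g : SU2) (s : Gam 1) :
    gamVec (gamRep 1 g s) = g • gamVec s := by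
  refine gamVec_eq fun u hu hu1 => ?_
  have hv : g⁻¹ • u ≠ 0 := (smul_ne_zero_iff_ne g⁻¹).mpr hu
  change g • ((s : ContSections) : CP1 → C2) (g⁻¹ • Projectivization.mk ℂ u hu) = _
  rw [Projectivization.smul_mk, gamVec_eval hε s _ hv ((norm_su2_smul _ _).trans hu1), smul_comm g,
    smul_inv_smul]
  congr 1
  have h := (su2Isometry g).inner_map_map (g⁻¹ • u) (gamVec s)
  change inner ℂ (g • g⁻¹ • u) (g • gamVec s) = _ at h
  rw [← h, smul_inv_smul]

/-! ### Equivariant maps to `Γ²` -/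

/-- For `k = 2, 3, 4, 5` a map `Γ^{2k} → Γ²` that commutes with the binary icosahedral group
vanishes. -/
theorem gam_equivariant_eq_zero {ε : ℂ} (hε : IsPrimitiveRoot ε 5) {k : ℕ}
    (hk : 2 * k - 1 = 3 ∨ 2 * k - 1 = 5 ∨ 2 * k - 1 = 7 ∨ 2 * k - 1 = 9) (Q : Gam k →ₗ[ℂ] Gam 1)
    (hQ : ∀ (g : icosa ε hε) s, Q (gamRep k g s) = gamRep 1 g (Q s)) : Q = 0 := by
  have := Fintype.ofFinite (icosa ε hε)
  refine equivariant_eq_zero_of_injective (V := Gam k) (V' := L2Sections) (W := Gam 1)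
    (G := icosa ε hε) ((gamRep k).comp (icosa ε hε).subtype) (l2Rep.comp (icosa ε hε).subtype)
    ((gamRep 1).comp (icosa ε hε).subtype) (gamToL2 k) (gamToL2_injective k)
    (fun g v => gamToL2_equivariant k g v) (l2Isotypic (2 * k - 1)) (gamToL2_mem k) ?_ Q hQ
  intro L hL
  refine iSup_le fun φ => ?_
  rintro _ ⟨p, rfl⟩
  -- The composite `Sⁿ → L² → Γ² → ℂ²` is equivariant under `G`, so the monomial computation
  -- applies.
  have h0 : (gamVec ∘ₗ L) ∘ₗ φ.toLinearMap = 0 := by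
    refine symPow_equivariant_eq_zero hε hk _ fun g hg p => ?_
    change gamVec (L (φ (symRep _ g p))) = g • gamVec (L (φ p))
    rw [φ.isIntertwining, ← gamVec_equivariant hε]
    exact congrArg gamVec (hL ⟨g, hg⟩ (φ p))
  rw [LinearMap.mem_ker]
  refine gamVec_injective hε ?_
  rw [map_zero]
  exact LinearMap.congr_fun h0 p

/-- An endomorphism of trace `2` of a subspace of `ℂ²` stable under `S` and `U`, which commutes with
`S` and `U`, is the identity. -/
theorem eq_id_of_trace_eq_two {ε : ℂ} (hε : IsPrimitiveRoot ε 5) {V : Type*} [AddCommGroup V]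
    [Module ℂ V] (J : V →ₗ[ℂ] C2) (hinj : Function.Injective J) (S U Q : V →ₗ[ℂ] V)
    (hJS : ∀ v, J (S v) = genS hε • J v) (hJU : ∀ v, J (U v) = genU • J v)
    (hQS : ∀ v, Q (S v) = S (Q v)) (hQU : ∀ v, Q (U v) = U (Q v))
    (htr : LinearMap.trace ℂ V Q = 2) : Q = LinearMap.id := by
  have hd : ε ^ 3 - ε ^ 2 ≠ 0 := fun h => root_diff_ne_zero hε (by linear_combination -h)
  -- Trace 2 excludes `V = 0`, and `U` brings a nonzero second coordinate into the first place.
  obtain ⟨t, ht⟩ : ∃ t : V, J t 0 ≠ 0 := by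
    by_contra! h
    have hzero : ∀ t : V, t = 0 := by
      intro t
      apply hinj
      rw [map_zero]
      ext i
      fin_cases i
      · exact h t
      · have h1 := h (U t)
        rw [hJU, (genU_smul _).1] at h1
        exact h1
    have hQ0 : Q = 0 := LinearMap.ext fun s => hzero _
    rw [hQ0, map_zero] at htr
    norm_num at htr
  obtain ⟨a, ha⟩ : ∃ a, J a = EuclideanSpace.single 0 1 := by
    -- `S - ε²` kills the second coordinate and multiplies the first by `ε³ - ε²`.
    refine ⟨((ε ^ 3 - ε ^ 2) * J t 0)⁻¹ • (S t - ε ^ 2 • t), ?_⟩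
    rw [map_smul, map_sub, map_smul, hJS]
    ext i
    fin_cases i
    · change _ * ((genS hε • J t) 0 - ε ^ 2 * J t 0) = _
      rw [(genS_smul hε _).1, ← sub_mul, inv_mul_cancel₀ (mul_ne_zero hd ht)]
      simp
    · change _ * ((genS hε • J t) 1 - ε ^ 2 * J t 1) = _
      rw [(genS_smul hε _).2, sub_self, mul_zero]
      simp
  have hb : J (-U a) = EuclideanSpace.single 1 1 := by
    rw [map_neg, hJU, ha]
    ext i
    fin_cases i
    · change -(genU • (EuclideanSpace.single 0 1 : C2)) 0 = _
      rw [(genU_smul _).1]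
      simp
    · change -(genU • (EuclideanSpace.single 0 1 : C2)) 1 = _
      rw [(genU_smul _).2]
      simp
  have hv : ∀ v : C2, J (v 0 • a + v 1 • -U a) = v := by
    intro v
    rw [map_add, map_smul, map_smul, ha, hb]
    ext i
    fin_cases i <;> simp
  have hab : ∀ s, s = J s 0 • a + J s 1 • -U a := fun s => hinj (hv (J s)).symm
  have hfin : LinearMap.trace ℂ V LinearMap.id = 2 := by
    have e := LinearEquiv.ofBijective J ⟨hinj, fun v => ⟨_, hv v⟩⟩
    have : Module.Finite ℂ V := Module.Finite.equiv e.symm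
    rw [LinearMap.trace_id, e.finrank_eq, finrank_euclideanSpace_fin]
    norm_num
  -- `Q` preserves the `ε³`-eigenspace of `S`, which is spanned by `a`; commutation with `U` then
  -- forces the same scalar on `-U a`.
  have hQa : Q a = J (Q a) 0 • a := by
    have hSa : S a = ε ^ 3 • a := by
      apply hinj
      rw [hJS, map_smul, ha]
      ext i
      fin_cases i
      · exact (genS_smul hε _).1
      · refine (genS_smul hε _).2.trans ?_
        simp
    have h1 := hQS a
    rw [hSa, map_smul] at h1
    have h2 := congrArg (fun s => J s 1) h1
    simp only [map_smul, hJS, (genS_smul hε _).2, PiLp.smul_apply, smul_eq_mul] at h2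
    have h3 : (ε ^ 3 - ε ^ 2) * J (Q a) 1 = 0 := by linear_combination h2
    have h4 := (mul_eq_zero.mp h3).resolve_left hd
    have h5 := hab (Q a)
    rwa [h4, zero_smul, add_zero] at h5
  generalize J (Q a) 0 = c at hQa
  have hQc : Q = c • LinearMap.id := by
    refine LinearMap.ext fun s => ?_
    rw [hab s, map_add, map_smul, map_smul, map_neg, hQU, hQa, LinearMap.smul_apply,
      LinearMap.id_apply, smul_add, smul_comm c, smul_comm c, map_smul, smul_neg c]
  have hc : c = 1 := by
    rw [hQc, map_smul, hfin, smul_eq_mul] at htr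
    linear_combination (1 / 2) * htr
  rw [hQc, hc, one_smul]

/-- A map `Γ² → Γ²` of trace `2` that commutes with the binary icosahedral group is the identity. -/
theorem gam_one_equivariant_eq_id {ε : ℂ} (hε : IsPrimitiveRoot ε 5) (Q : Gam 1 →ₗ[ℂ] Gam 1)
    (hQ : ∀ (g : icosa ε hε) s, Q (gamRep 1 g s) = gamRep 1 g (Q s))
    (htr : LinearMap.trace ℂ (Gam 1) Q = 2) : Q = LinearMap.id :=
  eq_id_of_trace_eq_two (V := Gam 1) hε gamVec (gamVec_injective hε) (gamRep 1 (genS hε))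
    (gamRep 1 genU) Q (gamVec_equivariant hε _) (gamVec_equivariant hε _)
    (hQ ⟨_, genS_mem hε⟩) (hQ ⟨_, genU_mem hε⟩) htr

/-! ### From the trace on `H` to the trace on `Γ²` -/

/-- `LinearMap.trace` is 0 by definition when there is no finite basis. The trace hypothesis thus
yields finite dimension of `H` without any computation of the `Γ^{2k}`. -/
theorem finite_of_trace_ne_zero {M : Type*} [AddCommMonoid M] [Module ℂ M] {f : M →ₗ[ℂ] M}
    (h : LinearMap.trace ℂ M f ≠ 0) : Module.Finite ℂ M := by
  by_contra hM
  refine h ?_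
  rw [LinearMap.trace, dif_neg, LinearMap.zero_apply]
  rintro ⟨s, ⟨b⟩⟩
  exact hM (Module.Finite.of_basis b)

theorem trace_comp_comm_of_ne_zero {M N : Type*} [AddCommMonoid M] [Module ℂ M] [AddCommMonoid N]
    [Module ℂ N] (i : N →ₗ[ℂ] M) (hi : Function.Injective i) (f : M →ₗ[ℂ] N)
    (h : LinearMap.trace ℂ M (i ∘ₗ f) ≠ 0) :
    LinearMap.trace ℂ N (f ∘ₗ i) = LinearMap.trace ℂ M (i ∘ₗ f) := by
  let : AddCommGroup M := Module.addCommMonoidToAddCommGroup ℂ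
  let : AddCommGroup N := Module.addCommMonoidToAddCommGroup ℂ
  have hM : Module.Finite ℂ M := finite_of_trace_ne_zero h
  have hN : Module.Finite ℂ N := Module.Finite.of_injective i hi
  exact LinearMap.trace_comp_comm' i f

theorem trace_Psi_comp_inclTwo (A : LocalFamily Fiber (Gam 1))
    (htr : LinearMap.trace ℂ H (inclTwo ∘ₗ Psi A) = 2) :
    LinearMap.trace ℂ (Gam 1) (Psi A ∘ₗ inclTwo) = 2 := by
  rw [← htr]
  refine trace_comp_comm_of_ne_zero (M := H) (N := Gam 1) inclTwo
    (DirectSum.of_injective (0 : Fin 5)) (Psi A) ?_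
  exact htr.trans_ne two_ne_zero

/-! ### Averaged pairs are designs -/

/-- The average of a pair of trace `2` over the binary icosahedral group is a `τ`-design. -/
theorem isDesign_average_icosa (ε : ℂ) (hε : IsPrimitiveRoot ε 5)
    (A : LocalFamily Fiber (Gam 1))
    (htr : LinearMap.trace ℂ H (inclTwo ∘ₗ Psi A) = 2)
    (Y : LocalFamily Fiber (Gam 1))
    (hY : Y = ((1 : ℂ) / (Nat.card (icosa ε hε) : ℂ)) •
      orbitSum (icosa ε hε) A) :
    LocalFamily.IsDesign ⊤ evalH
        (tau.domRestrict ⊤) Y ∧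
      (∀ s : Gam 1,
        Psi Y (DirectSum.lof ℂ (Fin 5) (fun j => Gam (j.val + 1)) 0 s)
          = s) ∧
      (∀ j : Fin 5, j ≠ 0 → ∀ s : Gam (j.val + 1),
        Psi Y (DirectSum.lof ℂ (Fin 5) (fun j => Gam (j.val + 1)) j s)
          = 0) := by
  have := Fintype.ofFinite (icosa ε hε)
  have hav := Psi_average (icosa ε hε) A
  rw [← hY] at hav
  have hequi : ∀ (j : Fin 5) (g : icosa ε hε) s,
      (Psi Y ∘ₗ incl j) (gamRep (j.val + 1) g s) = gamRep 1 g ((Psi Y ∘ₗ incl j) s) := by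
    intro j g s
    rw [hav j]
    exact average_equivariant (V := Gam (j.val + 1)) (W := Gam 1) _ _ _ g s
  have h0 : ∀ s : Gam 1, Psi Y (incl 0 s) = s := by
    have htr0 : LinearMap.trace ℂ (Gam 1) (Psi Y ∘ₗ incl 0) = 2 := by
      rw [hav 0]
      exact (trace_average (V := Gam 1) _ _).trans (trace_Psi_comp_inclTwo A htr)
    exact LinearMap.congr_fun (gam_one_equivariant_eq_id hε (Psi Y ∘ₗ incl 0) (hequi 0) htr0)
  have h1 : ∀ j : Fin 5, j ≠ 0 → ∀ s : Gam (j.val + 1), Psi Y (incl j s) = 0 := by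
    intro j hj
    have hk : 2 * (j.val + 1) - 1 = 3 ∨ 2 * (j.val + 1) - 1 = 5 ∨ 2 * (j.val + 1) - 1 = 7 ∨
        2 * (j.val + 1) - 1 = 9 := by
      have := Fin.val_ne_zero_iff.mpr hj
      omega
    exact LinearMap.congr_fun (gam_equivariant_eq_zero hε hk (Psi Y ∘ₗ incl j) (hequi j))
  refine ⟨?_, h0, h1⟩
  -- A linear map on the direct sum is determined by its restrictions to the summands, which are now
  -- known.
  have hPsi : Psi Y = tau := by
    refine DirectSum.linearMap_ext ℂ fun j => LinearMap.ext fun s => ?_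
    rw [LinearMap.comp_apply, LinearMap.comp_apply]
    by_cases hj : j = 0
    · subst hj
      exact (h0 s).trans (DirectSum.component.lof_self ℂ (M := fun j : Fin 5 => Gam (j.val + 1)) 0 s).symm
    · refine (h1 j hj s).trans ?_
      rw [tau, DirectSum.component.of, dif_neg hj]
  intro s
  have h : Psi Y s.1 = ∑ x ∈ Y.X, (Y.lam x ∘ₗ evalH x) s.1 := LinearMap.sum_apply _ _ _
  rw [← h, hPsi]
  rfl

end TautDesign

end

theorem mainTheorem1 (ε : ℂ) (hε : IsPrimitiveRoot ε 5)
    (A : TautDesign.LocalFamily TautDesign.Fiber (TautDesign.Gam 1))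
    (htr : LinearMap.trace ℂ TautDesign.H (TautDesign.inclTwo ∘ₗ TautDesign.Psi A) = 2)
    (Y : TautDesign.LocalFamily TautDesign.Fiber (TautDesign.Gam 1))
    (hY : Y = ((1 : ℂ) / (Nat.card (TautDesign.icosa ε hε) : ℂ)) •
      TautDesign.orbitSum (TautDesign.icosa ε hε) A) :
    TautDesign.LocalFamily.IsDesign ⊤ TautDesign.evalH
        (TautDesign.tau.domRestrict ⊤) Y ∧
      (∀ s : TautDesign.Gam 1,
        TautDesign.Psi Y (DirectSum.lof ℂ (Fin 5) (fun j => TautDesign.Gam (j.val + 1)) 0 s)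
          = s) ∧
      (∀ j : Fin 5, j ≠ 0 → ∀ s : TautDesign.Gam (j.val + 1),
        TautDesign.Psi Y (DirectSum.lof ℂ (Fin 5) (fun j => TautDesign.Gam (j.val + 1)) j s)
          = 0) :=
  TautDesign.isDesign_average_icosa ε hε A htr Y hY
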